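/- **Setting.** Let $\mathcal A=\prod_{i\ge0}\mathcal A_i$ be a commutative graded $\mathbb Q$-algebra with $\mathcal A_i\mathcal A_j\subset\mathcal A_{i+j}$ and a derivation $\partial$ acting componentwise with $\partial\mathcal A_i\subset\mathcal A_{i+1}$; put $\mathcal A_{\ge r}=\prod_{i\ge r}\mathcal A_i$. The elements of $\mathcal A$ are regarded as functions of $\mathbf t=(t_1=x,t_2,t_3,\dots)$ and $\hat{\mathbf t}=(\hat t_1,\hat t_2,\dots)$: there are given pairwise commuting derivations $\partial/\partial t_k$, $\partial/\partial\hat t_k$ $(k\ge1)$ of $\mathcal A$ which map each $\mathcal A_{\ge r}$ into itself, with $\partial/\partial t_1=\partial$. For $g\in\mathcal A$, $g(\mathbf t',\hat{\mathbf t}')$ denotes the formal Taylor series of $g$ about $(\mathbf t,\hat{\mathbf t})$ in $\mathbf t'-\mathbf t$, $\hat{\mathbf t}'-\hat{\mathbf t}$. Let $\mathcal D^-$ be the algebra of operators $\sum_{i\le k}f_i\partial^i$ ($k\in\mathbb Z$), and $\mathcal D^+$ the algebra of operators $\sum_{i\in\mathbb Z}f_i\partial^i$ such that, for some $k\in\mathbb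 Z$, $f_i\in\mathcal A_{\ge\max(0,k-i)}$ for all $i$; in both, $f\partial^i\cdot g\partial^j=\sum_{r\ge0}\binom ir f\,\partial^r(g)\,\partial^{i+j-r}$. For $F=\sum f_i\partial^i$ put $F_+=\sum_{i\ge0}f_i\partial^i$, $F_-=\sum_{i<0}f_i\partial^i$, $F^*=\sum(-\partial)^if_i$. For $a_i,b_i\in\mathcal A$ $(i\ge 1)$ and an invertible element of $\mathcal A$ written $e^f$ (only $e^f$ occurs below, with inverse $e^{-f}$), let $$\Phi=1+\sum_{i\ge1}a_i\partial^{-i}\in\mathcal D^-,\qquad \hat\Phi=e^f\Bigl(1+\sum_{i\ge1}b_i\partial^i\Bigr)\in\mathcal D^+,$$ with inverses in $\mathcal D^-$ and $\mathcal D^+$ respectively, $P=\Phi\partial\Phi^{-1}$ and $\hat P=\hat\Phi\partial^{-1}\hat\Phi^{-1}$. The *extended KP hierarchy* is the system, for $k\ge1$ (with $\hat P^{-1}$ the inverse in $\mathcal D^+$), $$\frac{\partial\Phi}{\partial t_k}=-(P^k)_-\Phi,\quad \frac{\partial\hat\Phi}{\partial t_k}=\bigl((P^k)_+-\delta_{k1}\hat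 P^{-1}\bigr)\hat\Phi,\quad \frac{\partial\Phi}{\partial\hat t_k}=-(\hat P^k)_-\Phi,\quad \frac{\partial\hat\Phi}{\partial\hat t_k}=(\hat P^k)_+\hat\Phi .$$ Let $\xi(\mathbf t;z)=\sum_{k\ge1}t_kz^k$, and let operators act on exponentials by $\partial^ie^{\pm xz}=(\pm z)^ie^{\pm xz}$, $i\in\mathbb Z$. The (adjoint) Baker–Akhiezer functions of a solution are $$\psi=\Phi e^{\xi(\mathbf t;z)},\quad \hat\psi=\hat\Phi e^{xz-\xi(\hat{\mathbf t};z^{-1})},\quad \psi^\dagger=(\Phi^{-1})^*e^{-\xi(\mathbf t;z)},\quad \hat\psi^\dagger=(\hat\Phi^{-1})^*e^{-xz+\xi(\hat{\mathbf t};z^{-1})}.$$ Let $\mathrm{res}_z\sum_i g_iz^i=g_{-1}$; the residues below are formal power series in $\mathbf t'-\mathbf t$, $\hat{\mathbf t}'-\hat{\mathbf t}$, obtained by multiplying the exponential factors at the two times and expanding. **Theorem.** (1) For every solution of the extended KP hierarchy, $$\mathrm{res}_z\bigl(\psi(\mathbf t,\hat{\mathbf t};z)\,\psi^\dagger(\mathbf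 t',\hat{\mathbf t}';z)\bigr)=\mathrm{res}_z\bigl(\hat\psi(\mathbf t,\hat{\mathbf t};z)\,\hat\psi^\dagger(\mathbf t',\hat{\mathbf t}';z)\bigr)\qquad(*)$$ for arbitrary times, and the four functions have the form $$\psi=\Bigl(1+\sum_{i\ge1}a_iz^{-i}\Bigr)e^{\xi(\mathbf t;z)},\qquad \hat\psi=e^f\Bigl(1+\sum_{i\ge1}b_iz^i\Bigr)e^{xz-\xi(\hat{\mathbf t};z^{-1})},$$ $$\psi^\dagger=\Bigl(1+\sum_{i\ge1}a_i^\dagger z^{-i}\Bigr)e^{-\xi(\mathbf t;z)},\qquad \hat\psi^\dagger=e^{-f}\Bigl(\rho+\sum_{i\ge1}b_i^\dagger z^i\Bigr)e^{-xz+\xi(\hat{\mathbf t};z^{-1})}\qquad(**)$$ where $\rho$ is invertible and $\rho-1\in\mathcal A_{\ge1}$. (2) Conversely, if four functions of the form $(**)$, with arbitrary $a_i,b_i,a_i^\dagger,b_i^\dagger\in\mathcal A$ and arbitrary invertible $e^f,\rho\in\mathcal A$ (for instance $\rho=1$), satisfy $(*)$, then they are the Baker–Akhiezer functions $\psi,\hat\psi$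 and the adjoint Baker–Akhiezer functions $\psi^\dagger,\hat\psi^\dagger$ of a solution of the extended KP hierarchy. -/

import Mathlib

namespace ExtendedKP

/-- A graded differential algebra `A = ∏_{i ≥ 0} A_i` over `ℚ`: `comp i` is the projection onto the
homogeneous component `A_i`, an element is the same thing as an arbitrary sequence of homogeneous
components, `A_i * A_j ⊆ A_{i+j}`, and the derivation `d` maps `A_i` to `A_{i+1}`. -/
class GradedDifferentialAlgebra (A : Type*) [CommRing A] [Algebra ℚ A] where
  comp : ℕ → A →ₗ[ℚ] A
  comp_same : ∀ (i : ℕ) (f : A), comp i (comp i f) = comp i f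
  comp_ne : ∀ (i j : ℕ) (f : A), i ≠ j → comp i (comp j f) = 0
  complete : ∀ g : ℕ → A, ∃! f : A, ∀ i, comp i f = comp i (g i)
  comp_mul : ∀ (n : ℕ) (f g : A),
    comp n (f * g) = ∑ p ∈ Finset.HasAntidiagonal.antidiagonal n, comp p.1 f * comp p.2 g
  d : Derivation ℚ A A
  comp_zero_d : ∀ f : A, comp 0 (d f) = 0
  comp_succ_d : ∀ (n : ℕ) (f : A), comp (n + 1) (d f) = d (comp n f)

/-- The time variables: `Sum.inl k` is `t_k` and `Sum.inr k` is `t̂_k`, for `k ≥ 1`. -/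
abbrev Time : Type := ℕ+ ⊕ ℕ+

section Graded

variable {A : Type*} [CommRing A] [Algebra ℚ A] [GradedDifferentialAlgebra A]

/-- `f ∈ A_{≥ r} = ∏_{i ≥ r} A_i` (all of `A` when `r ≤ 0`). -/
def DegGE (r : ℤ) (f : A) : Prop :=
  ∀ j : ℕ, (j : ℤ) < r → GradedDifferentialAlgebra.comp j f = 0

/-- The sum of a family each of whose homogeneous components has finite support. -/
noncomputable def gsum {ι : Type*} (g : ι → A) : A :=
  Classical.choose (GradedDifferentialAlgebra.complete
    (fun n => ∑ᶠ i, GradedDifferentialAlgebra.comp n (g i))).exists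

end Graded

/-- The elements of `A` regarded as functions of all the times `(t, t̂)`: commuting partial
derivatives `∂/∂t_k`, `∂/∂t̂_k` that do not lower the degree, where `t_1 = x`, so that
`∂/∂t_1` is the derivation of `A`. -/
structure TimeFlows (A : Type*) [CommRing A] [Algebra ℚ A] [GradedDifferentialAlgebra A] where
  der : Time → Derivation ℚ A A
  comm : ∀ (σ τ : Time) (f : A), der σ (der τ f) = der τ (der σ f)
  der_x : der (Sum.inl 1) = GradedDifferentialAlgebra.d
  degGE : ∀ (σ : Time) (r : ℤ) (f : A), DegGE r f → DegGE r (der σ f)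

/-! Operators `∑_{i ∈ ℤ} f_i ∂^i`, given by their coefficients. -/

section Operators

variable {A : Type*} [CommRing A] [Algebra ℚ A] [GradedDifferentialAlgebra A]

/-- The space of all formal expressions `∑_{i ∈ ℤ} f_i ∂^i`. -/
abbrev Op (A : Type*) : Type _ := ℤ → A

/-- Pseudo-differential operators of the first type: orders bounded above. -/
def DMinus (A : Type*) [CommRing A] : Set (Op A) :=
  {F | ∃ k : ℤ, ∀ i : ℤ, k < i → F i = 0}

/-- Pseudo-differential operators of the second type: `f_i ∈ A_{≥ max(0, k - i)}` for some `k`. -/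
def DPlus (A : Type*) [CommRing A] [Algebra ℚ A] [GradedDifferentialAlgebra A] : Set (Op A) :=
  {F | ∃ k : ℤ, ∀ i : ℤ, DegGE (k - i) (F i)}

/-- The monomial `f ∂^i`. -/
def Op.monomial (f : A) (i : ℤ) : Op A := fun n => if n = i then f else 0

/-- The product, from `f ∂^i · g ∂^j = ∑_{r ≥ 0} (i choose r) f ∂^r(g) ∂^{i+j-r}`. The sum for each
coefficient is locally finite when both factors are of the first type, or both of the second. -/
noncomputable def Op.mul (F G : Op A) : Op A := fun n =>
  gsum fun p : ℤ × ℕ => (Ring.choose p.1 p.2 : ℤ) •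
    (F p.1 * (⇑(GradedDifferentialAlgebra.d (A := A)))^[p.2] (G (n - p.1 + p.2)))

noncomputable def Op.pow (F : Op A) : ℕ → Op A
  | 0 => Op.monomial 1 0
  | n + 1 => Op.mul (Op.pow F n) F

open Classical in
/-- The two-sided inverse of `F` inside `S`, where `S` is `DMinus A` or `DPlus A`
(and `0` if there is none). -/
noncomputable def Op.inv (S : Set (Op A)) (F : Op A) : Op A :=
  if h : ∃ G ∈ S, Op.mul F G = Op.monomial 1 0 ∧ Op.mul G F = Op.monomial 1 0
  then Classical.choose h else 0

/-- The differential part `F_+`. -/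
def Op.pos (F : Op A) : Op A := fun n => if 0 ≤ n then F n else 0

/-- The negative part `F_-`. -/
def Op.neg (F : Op A) : Op A := fun n => if n < 0 then F n else 0

/-- The formal adjoint `(∑ f_i ∂^i)^* = ∑ (-∂)^i f_i
  = ∑_i ∑_{r ≥ 0} (-1)^i (i choose r) ∂^r(f_i) ∂^{i-r}`. -/
noncomputable def Op.adjoint (F : Op A) : Op A := fun n =>
  gsum fun r : ℕ => (((-1 : ℤˣ) ^ (n + r) : ℤˣ) : ℤ) • (Ring.choose (n + r) r : ℤ) •
    (⇑(GradedDifferentialAlgebra.d (A := A)))^[r] (F (n + r))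

/-- `c + ∑_{i ≥ 1} a_i X^{-i}`, for `X = ∂` or `X = z`. -/
def nonposSeries (c : A) (a : ℕ+ → A) : ℤ → A
  | Int.ofNat 0 => c
  | Int.ofNat (_ + 1) => 0
  | Int.negSucc n => a n.succPNat

/-- `c + ∑_{i ≥ 1} b_i X^i`, for `X = ∂` or `X = z`. -/
def nonnegSeries (c : A) (b : ℕ+ → A) : ℤ → A
  | Int.ofNat 0 => c
  | Int.ofNat (n + 1) => b n.succPNat
  | Int.negSucc _ => 0

end Operators

/-! Formal wave functions. -/

/-- A linear exponent `χ(t, t̂; z) = ∑_σ coeff σ * z ^ (pow σ) * σ`, the sum over all times `σ`. -/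
structure Phase where
  coeff : Time → ℤ
  pow : Time → ℤ

/-- `ξ(t; z) = ∑_{k ≥ 1} t_k z^k`. -/
def Phase.xi : Phase where
  coeff := Sum.elim (fun _ => 1) (fun _ => 0)
  pow := Sum.elim (fun k => (k : ℤ)) (fun _ => 0)

/-- `x z - ξ(t̂; z⁻¹) = t_1 z - ∑_{k ≥ 1} t̂_k z^{-k}`. -/
def Phase.xiHat : Phase where
  coeff := Sum.elim (fun k => if k = 1 then 1 else 0) (fun _ => -1)
  pow := Sum.elim (fun k => (k : ℤ)) (fun k => -(k : ℤ))

/-- `ε χ` for a sign `ε`. -/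
def Phase.smul (ε : ℤˣ) (χ : Phase) : Phase where
  coeff := fun σ => (ε : ℤ) * χ.coeff σ
  pow := χ.pow

/-- A formal function `(∑_{i ∈ ℤ} c_i(t, t̂) z^i) e^{χ(t, t̂; z)}`. -/
structure Wave (A : Type*) where
  coeff : ℤ → A
  phase : Phase

section Waves

variable {A : Type*} [CommRing A] [Algebra ℚ A] [GradedDifferentialAlgebra A]

/-- The action `F e^{ε χ}` of an operator on the exponential of `ε χ = ε (x z + ⋯)`, where the dots
do not depend on `x`: `∂^i e^{ε χ} = (ε z)^i e^{ε χ}` for all `i ∈ ℤ`. -/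
def Op.applyExp (ε : ℤˣ) (χ : Phase) (F : Op A) : Wave A where
  coeff := fun i => ((ε ^ i : ℤˣ) : ℤ) • F i
  phase := χ.smul ε

/-- The coefficient of `z^n` in `e^{χ(s, ŝ; z)}`, a power series in the variables `s, ŝ`. -/
noncomputable def Phase.expCoeff (A : Type*) [CommRing A] [Algebra ℚ A] (χ : Phase) (n : ℤ) :
    MvPowerSeries Time A := fun m =>
  if (m.sum fun σ e => (e : ℤ) * χ.pow σ) = n then
    algebraMap ℚ A (m.prod fun σ e => (χ.coeff σ : ℚ) ^ e / (e.factorial : ℚ))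
  else 0

/-- The mixed partial derivative `∏_σ (∂/∂σ)^{m_σ}`. -/
noncomputable def TimeFlows.mixed (T : TimeFlows A) (m : Time →₀ ℕ) : Module.End ℚ A :=
  m.support.noncommProd (fun σ => (T.der σ : Module.End ℚ A) ^ m σ)
    (fun σ _ τ _ _ => Commute.pow_pow (LinearMap.ext fun f => T.comm σ τ f) _ _)

/-- `g(t', t̂')` as a formal Taylor series about `(t, t̂)`, in the variables `s = t' - t` and
`ŝ = t̂' - t̂`. -/
noncomputable def TimeFlows.taylor (T : TimeFlows A) (g : A) : MvPowerSeries Time A := fun m =>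
  (m.prod fun _ e => (e.factorial : ℚ)⁻¹) • T.mixed m g

/-- `res_z (φ(t, t̂; z) η(t', t̂'; z))` as a power series in `t' - t` and `t̂' - t̂`, for wave
functions with opposite phases `-χ` and `χ`: if `φ = ∑ u_i z^i e^{-χ}` and `η = ∑ v_j z^j e^{χ}`,
this is the coefficient of `z^{-1}` in
`(∑ u_i(t, t̂) z^i) (∑ v_j(t', t̂') z^j) e^{χ(t' - t, t̂' - t̂; z)}`. -/
noncomputable def TimeFlows.residue (T : TimeFlows A) (φ η : Wave A) : MvPowerSeries Time A :=
  fun m => ∑ᶠ p : ℤ × ℤ, MvPowerSeries.coeff m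
    (MvPowerSeries.C (φ.coeff p.1) * T.taylor (η.coeff p.2) *
      η.phase.expCoeff A (-1 - p.1 - p.2))

/-- The bilinear equation
`res_z (ψ(t, t̂; z) ψ†(t', t̂'; z)) = res_z (ψ̂(t, t̂; z) ψ̂†(t', t̂'; z))`. -/
def TimeFlows.Bilinear (T : TimeFlows A) (ψ ψd ψh ψhd : Wave A) : Prop :=
  T.residue ψ ψd = T.residue ψh ψhd

/-- The coefficientwise time derivative of an operator. -/
def TimeFlows.derOp (T : TimeFlows A) (σ : Time) (F : Op A) : Op A := fun n => T.der σ (F n)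

end Waves

/-- The unknowns of the hierarchy: `a_i`, `b_i` (`i ≥ 1`) and the invertible function `e^f`, through which alone `f`
enters the operators and the wave functions. -/
structure Dressing (A : Type*) [CommRing A] where
  a : ℕ+ → A
  expf : Aˣ
  b : ℕ+ → A

namespace Dressing

variable {A : Type*} [CommRing A]

/-- `Φ = 1 + ∑_{i ≥ 1} a_i ∂^{-i}`. -/
def Phi (S : Dressing A) : Op A := nonposSeries 1 S.a

/-- `Φ̂ = e^f (1 + ∑_{i ≥ 1} b_i ∂^i)`. -/
def PhiHat (S : Dressing A) : Op A := fun n => (S.expf : A) * nonnegSeries 1 S.b n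

variable [Algebra ℚ A] [GradedDifferentialAlgebra A]

/-- `Φ⁻¹`, in the algebra of operators of the first type. -/
noncomputable def PhiInv (S : Dressing A) : Op A := Op.inv (DMinus A) S.Phi

/-- `Φ̂⁻¹`, in the algebra of operators of the second type. -/
noncomputable def PhiHatInv (S : Dressing A) : Op A := Op.inv (DPlus A) S.PhiHat

/-- `P = Φ ∂ Φ⁻¹`. -/
noncomputable def P (S : Dressing A) : Op A :=
  Op.mul (Op.mul S.Phi (Op.monomial 1 1)) S.PhiInv

/-- `P̂ = Φ̂ ∂⁻¹ Φ̂⁻¹`. -/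
noncomputable def PHat (S : Dressing A) : Op A :=
  Op.mul (Op.mul S.PhiHat (Op.monomial 1 (-1))) S.PhiHatInv

/-- The extended KP hierarchy: for all `k ≥ 1`,
`∂Φ/∂t_k = -(P^k)_- Φ`, `∂Φ̂/∂t_k = ((P^k)_+ - δ_{k1} P̂⁻¹) Φ̂`,
`∂Φ/∂t̂_k = -(P̂^k)_- Φ`, `∂Φ̂/∂t̂_k = (P̂^k)_+ Φ̂`. -/
def IsSolution (S : Dressing A) (T : TimeFlows A) : Prop :=
  ∀ k : ℕ+,
    T.derOp (Sum.inl k) S.Phi = -Op.mul (Op.neg (Op.pow S.P k)) S.Phi ∧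
    T.derOp (Sum.inl k) S.PhiHat =
      Op.mul (Op.pos (Op.pow S.P k) - (if k = 1 then Op.inv (DPlus A) S.PHat else 0)) S.PhiHat ∧
    T.derOp (Sum.inr k) S.Phi = -Op.mul (Op.neg (Op.pow S.PHat k)) S.Phi ∧
    T.derOp (Sum.inr k) S.PhiHat = Op.mul (Op.pos (Op.pow S.PHat k)) S.PhiHat

/-- `ψ = Φ e^{ξ(t; z)}`. -/
def psi (S : Dressing A) : Wave A := S.Phi.applyExp 1 Phase.xi

/-- `ψ̂ = Φ̂ e^{x z - ξ(t̂; z⁻¹)}`. -/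
def psiHat (S : Dressing A) : Wave A := S.PhiHat.applyExp 1 Phase.xiHat

/-- `ψ† = (Φ⁻¹)^* e^{-ξ(t; z)}`. -/
noncomputable def psiDag (S : Dressing A) : Wave A :=
  S.PhiInv.adjoint.applyExp (-1) Phase.xi

/-- `ψ̂† = (Φ̂⁻¹)^* e^{-x z + ξ(t̂; z⁻¹)}`. -/
noncomputable def psiHatDag (S : Dressing A) : Wave A :=
  S.PhiHatInv.adjoint.applyExp (-1) Phase.xiHat

end Dressing

section Forms

variable {A : Type*} [CommRing A]

/-- `(1 + ∑_{i ≥ 1} a_i z^{-i}) e^{ε ξ(t; z)}`. -/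
def waveXi (ε : ℤˣ) (a : ℕ+ → A) : Wave A where
  coeff := nonposSeries 1 a
  phase := Phase.xi.smul ε

/-- `e (c + ∑_{i ≥ 1} b_i z^i) e^{ε (x z - ξ(t̂; z⁻¹))}`. -/
def waveXiHat (ε : ℤˣ) (e c : A) (b : ℕ+ → A) : Wave A where
  coeff := fun n => e * nonnegSeries c b n
  phase := Phase.xiHat.smul ε

end Forms

end ExtendedKP

/-! Both directions pass through a reformulation of the hierarchy (`Dressing.isSolution_iff`): for
every time there is one operator R, lying in both algebras, whose action on ψ and on ψ̂ is the time
derivative. For t_k it is (P^k)_+, for t̂_k it is -(P̂^k)_-. Conversely, comparing orders in the two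
equations forces R to be this operator. The term with P̂⁻¹ only compensates the x z in the phase of
ψ̂.

The bilinear equation is turned into countably many identities in `A`: its Taylor coefficients
vanish exactly when the residue pairings of (ψ, ψ̂) with all iterated time derivatives of (ψ†, ψ̂†)
agree (`residue_eq_iff`). Pairing with the adjoint wave function computes the coefficient of ∂⁻¹ in
a product of operators (`mul_apply_neg_one`). So for an operator Y in both algebras, YΦΦ⁻¹ = Y =
YΦ̂Φ̂⁻¹ gives the identity without derivatives. The product rule moves each derivative onto YΦ and
YΦ̂, where compatibility replaces Y by another operator acting on both; this yields (1).

For (2), consider all pairs (F, F̂) satisfying these identities in place of (ψ, ψ̂). They are closed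
under time derivatives and under differential operators acting from the left. Such a pair vanishes
if F has only negative and F̂ only nonnegative powers (`Orthogonal.eq_zero`). Hence, if F̂ has no
negative powers, subtracting the differential part of FΦ⁻¹ shows that the pair is M(Φ, Φ̂). Finitely
many negative powers of F̂ are removed with the help of the t̂_k-derivatives of ψ̂, whose lowest
term is -e^f z^{-k} (`Dressing.exists_op`). Applied to the time derivatives of (ψ, ψ̂), this gives
compatibility. The dual triangular argument (`Dressing.orthogonal_unique`) identifies the given
adjoint functions with the genuine ones. -/

namespace ExtendedKP

open Finset Function GradedDifferentialAlgebra

/-! ### Locally finite sums in the graded algebra. -/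

section GradedSums

variable {A : Type*} [CommRing A] [Algebra ℚ A] [GradedDifferentialAlgebra A]

theorem ext_comp {f g : A} (h : ∀ n, comp n f = comp n g) : f = g :=
  (GradedDifferentialAlgebra.complete (fun _ => g)).unique h fun _ => rfl

theorem eq_zero_of_comp {f : A} (h : ∀ n, comp n f = 0) : f = 0 :=
  ext_comp fun n => by rw [h, map_zero]

theorem comp_comp (i j : ℕ) (f : A) : comp i (comp j f) = if i = j then comp i f else 0 := by
  split_ifs with h
  · subst h; exact comp_same _ _
  · exact comp_ne _ _ _ h

/-- Each homogeneous component of the family `g` has finite support. -/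
def LocFinite {ι : Type*} (g : ι → A) : Prop :=
  ∀ n : ℕ, (support fun i => comp n (g i)).Finite

/-- No finiteness is needed: for an infinite support both sides are the default value 0 of `finsum`.
-/
theorem comp_gsum {ι : Type*} (g : ι → A) (n : ℕ) :
    comp n (gsum g) = ∑ᶠ i, comp n (g i) := by
  have h := Classical.choose_spec (GradedDifferentialAlgebra.complete
    (fun n => ∑ᶠ i, comp n (g i))).exists n
  rw [gsum, h]
  by_cases hf : (support fun i => comp n (g i)).Finite
  · rw [map_finsum _ hf]
    simp only [comp_same]
  · rw [finsum_of_infinite_support hf, map_zero]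

theorem gsum_congr {ι : Type*} {g h : ι → A} (H : ∀ i, g i = h i) : gsum g = gsum h := by
  rw [funext H]

theorem gsum_zero {ι : Type*} : gsum (fun _ : ι => (0 : A)) = 0 :=
  ext_comp fun n => by simp [comp_gsum]

theorem gsum_eq_finsum {ι : Type*} {g : ι → A} (hg : (support g).Finite) :
    gsum g = ∑ᶠ i, g i :=
  ext_comp fun n => by rw [comp_gsum, map_finsum _ hg]

theorem gsum_fintype {ι : Type*} [Fintype ι] (g : ι → A) : gsum g = ∑ i, g i := by
  rw [gsum_eq_finsum (Set.toFinite _), finsum_eq_sum_of_fintype]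

theorem gsum_eq_single {ι : Type*} {g : ι → A} (a : ι) (h : ∀ i, i ≠ a → g i = 0) :
    gsum g = g a := by
  rw [gsum_eq_finsum, finsum_eq_single _ a h]
  exact (Set.finite_singleton a).subset fun i hi => by
    by_contra h'
    exact hi (h i h')

theorem gsum_eq_sum {ι : Type*} {g : ι → A} (s : Finset ι) (h : ∀ i, i ∉ s → g i = 0) :
    gsum g = ∑ i ∈ s, g i := by
  have hs : support g ⊆ (s : Set ι) := fun i hi => by
    by_contra h'
    exact hi (h i h')
  rw [gsum_eq_finsum (s.finite_toSet.subset hs), finsum_eq_sum_of_support_subset _ hs]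

theorem gsum_add {ι : Type*} {g h : ι → A} (hg : LocFinite g) (hh : LocFinite h) :
    gsum (fun i => g i + h i) = gsum g + gsum h :=
  ext_comp fun n => by
    simp only [comp_gsum, map_add]
    exact finsum_add_distrib (hg n) (hh n)

theorem gsum_comp_equiv {ι κ : Type*} (e : ι ≃ κ) (g : κ → A) :
    gsum (fun i => g (e i)) = gsum g :=
  ext_comp fun n => by
    simp only [comp_gsum]
    exact finsum_comp_equiv e (f := fun k => comp n (g k))

theorem LocFinite.comp_injective {ι κ : Type*} {g : κ → A} (hg : LocFinite g) {e : ι → κ}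
    (he : Injective e) : LocFinite fun i => g (e i) := fun n =>
  (hg n).preimage he.injOn

theorem LocFinite.zsmul {ι : Type*} {g : ι → A} (hg : LocFinite g) (c : ι → ℤ) :
    LocFinite fun i => c i • g i := fun n =>
  (hg n).subset fun i hi => by
    simp only [mem_support, map_zsmul] at hi ⊢
    exact right_ne_zero_of_smul hi

theorem DegGE.mul {r s : ℤ} {f g : A} (hf : DegGE r f) (hg : DegGE s g) :
    DegGE (r + s) (f * g) := fun j hj => by
  rw [comp_mul]
  refine Finset.sum_eq_zero fun p hp => ?_
  have hp' := mem_antidiagonal.1 hp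
  rcases lt_or_ge (p.1 : ℤ) r with h | h
  · rw [hf _ h, zero_mul]
  · rw [hg p.2 (by omega), mul_zero]

theorem DegGE.mono {r s : ℤ} {f : A} (hf : DegGE r f) (h : s ≤ r) : DegGE s f :=
  fun j hj => hf j (hj.trans_le h)

theorem degGE_of_nonpos {r : ℤ} (hr : r ≤ 0) (f : A) : DegGE r f := fun j hj => by omega

theorem DegGE.mul_left {r : ℤ} {f : A} (hf : DegGE r f) (a : A) : DegGE r (a * f) := by
  simpa using (degGE_of_nonpos le_rfl a).mul hf

theorem DegGE.deriv {r : ℤ} {f : A} (hf : DegGE r f) : DegGE (r + 1) (d f) := fun j hj => by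
  cases j with
  | zero => exact comp_zero_d f
  | succ n => rw [comp_succ_d, hf n (by push_cast at hj; omega), map_zero]

/-- A linear map which does not lower the degree. -/
def Filtered (φ : A →ₗ[ℚ] A) : Prop := ∀ (r : ℤ) (f : A), DegGE r f → DegGE r (φ f)

/-- What remains of `f` after removing the components of degree at most `n` lies in A_{≥ n+1}, and
`φ` keeps it there. This continuity is what lets `φ` pass through `gsum`. -/
theorem Filtered.comp_apply {φ : A →ₗ[ℚ] A} (hφ : Filtered φ) (n : ℕ) (f : A) :
    comp n (φ f) = ∑ i ∈ range (n + 1), comp n (φ (comp i f)) := by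
  have h : DegGE ((n : ℤ) + 1) (f - ∑ i ∈ range (n + 1), comp i f) := fun j hj => by
    rw [map_sub, map_sum]
    simp only [comp_comp]
    rw [Finset.sum_ite_eq, if_pos (by simp; omega), sub_self]
  have h' := hφ _ _ h n (by omega)
  rw [map_sub, map_sub, map_sum, map_sum, sub_eq_zero] at h'
  exact h'

theorem Filtered.support_subset {ι : Type*} {φ : A →ₗ[ℚ] A} (hφ : Filtered φ) (g : ι → A) (n : ℕ) :
    (support fun i => comp n (φ (g i))) ⊆
      ⋃ m ∈ range (n + 1), support fun i => comp m (g i) := fun i hi => by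
  rw [mem_support, hφ.comp_apply] at hi
  obtain ⟨m, hm, hm'⟩ := exists_ne_zero_of_sum_ne_zero hi
  simp only [Set.mem_iUnion]
  exact ⟨m, hm, fun h => hm' (by rw [show comp m (g i) = 0 from h, map_zero, map_zero])⟩

theorem LocFinite.map {ι : Type*} {φ : A →ₗ[ℚ] A} (hφ : Filtered φ) {g : ι → A}
    (hg : LocFinite g) : LocFinite fun i => φ (g i) := fun n =>
  ((range (n + 1)).finite_toSet.biUnion fun m _ => hg m).subset (hφ.support_subset g n)

theorem Filtered.map_gsum {ι : Type*} {φ : A →ₗ[ℚ] A} (hφ : Filtered φ) {g : ι → A}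
    (hg : LocFinite g) : φ (gsum g) = gsum fun i => φ (g i) :=
  ext_comp fun n => by
    rw [hφ.comp_apply, comp_gsum]
    simp only [fun i => hφ.comp_apply n (g i), comp_gsum]
    rw [finsum_sum_comm]
    · refine Finset.sum_congr rfl fun m _ => ?_
      rw [map_finsum φ (hg m), map_finsum]
      exact (hg m).subset fun i hi h => hi (by simp only [h, map_zero])
    · intro m _
      exact (hg m).subset fun i hi h => hi (by simp only [h, map_zero])

theorem filtered_mulLeft (a : A) : Filtered (LinearMap.mulLeft ℚ a) :=
  fun _ _ h => h.mul_left a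

theorem filtered_d : Filtered (GradedDifferentialAlgebra.d (A := A) : A →ₗ[ℚ] A) :=
  fun _ _ h => h.deriv.mono (by omega)

theorem mul_gsum {ι : Type*} (a : A) {g : ι → A} (hg : LocFinite g) :
    a * gsum g = gsum fun i => a * g i :=
  (filtered_mulLeft a).map_gsum hg

theorem LocFinite.mul_left {ι : Type*} (a : A) {g : ι → A} (hg : LocFinite g) :
    LocFinite fun i => a * g i :=
  LocFinite.map (filtered_mulLeft a) hg

theorem gsum_mul {ι : Type*} (a : A) {g : ι → A} (hg : LocFinite g) :
    gsum g * a = gsum fun i => g i * a := by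
  simp only [mul_comm _ a, mul_gsum a hg]

theorem gsum_neg {ι : Type*} (g : ι → A) : gsum (fun i => -g i) = -gsum g :=
  ext_comp fun n => by simp [comp_gsum, finsum_neg_distrib]

theorem zsmul_gsum {ι : Type*} (c : ℤ) {g : ι → A} (hg : LocFinite g) :
    c • gsum g = gsum fun i => c • g i := by
  simpa only [zsmul_eq_mul] using mul_gsum (c : A) hg

theorem LocFinite.d_iterate {ι : Type*} {g : ι → A} (hg : LocFinite g) (r : ℕ) :
    LocFinite fun i => (⇑(d (A := A)))^[r] (g i) := by
  induction r with
  | zero => exact hg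
  | succ r ih =>
    simp only [iterate_succ_apply']
    exact LocFinite.map filtered_d ih

theorem d_iterate_gsum {ι : Type*} {g : ι → A} (hg : LocFinite g) (r : ℕ) :
    (⇑(d (A := A)))^[r] (gsum g) = gsum fun i => (⇑(d (A := A)))^[r] (g i) := by
  induction r with
  | zero => rfl
  | succ r ih =>
    simp only [iterate_succ_apply', ih]
    exact filtered_d.map_gsum (hg.d_iterate r)

theorem gsum_sigma {ι : Type*} {κ : ι → Type*} {g : (Σ i, κ i) → A} (hg : LocFinite g) :
    gsum g = gsum fun i => gsum fun j => g ⟨i, j⟩ :=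
  ext_comp fun n => by
    simp only [comp_gsum]
    classical
    have hs := hg n
    set f : (Σ i, κ i) → A := fun p => comp n (g p) with hf
    have h1 : ∀ i, (support fun j => f ⟨i, j⟩).Finite := fun i =>
      hs.preimage (f := Sigma.mk i) sigma_mk_injective.injOn
    have h2 : (support fun i => ∑ᶠ j, f ⟨i, j⟩) ⊆ (hs.toFinset.image Sigma.fst : Set ι) := by
      intro i hi
      by_contra hc
      refine hi (finsum_eq_zero_of_forall_eq_zero fun j => ?_)
      by_contra hne
      exact hc (by simpa using ⟨j, hne⟩)
    rw [finsum_eq_sum_of_support_subset _ h2]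
    have h3 : ∀ i, ∑ᶠ j, f ⟨i, j⟩ = ∑ j ∈ (h1 i).toFinset, f ⟨i, j⟩ :=
      fun i => finsum_eq_sum _ (h1 i)
    simp only [h3]
    rw [Finset.sum_sigma' _ _ fun i j => f ⟨i, j⟩]
    refine finsum_eq_sum_of_support_subset _ fun p hp => ?_
    simp only [coe_sigma, Set.mem_sigma_iff, mem_coe, mem_image, Set.Finite.mem_toFinset]
    exact ⟨⟨p, hp, rfl⟩, hp⟩

theorem gsum_prod {ι κ : Type*} {g : ι × κ → A} (hg : LocFinite g) :
    gsum g = gsum fun i => gsum fun j => g (i, j) := by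
  rw [← gsum_comp_equiv (Equiv.sigmaEquivProd ι κ) g,
    gsum_sigma (hg.comp_injective (Equiv.injective _))]
  rfl

/-- Refining a locally finite family along a map with finite fibres. -/
theorem LocFinite.of_fibres {ι κ : Type*} {g : κ → A} (hg : LocFinite g) (e : ι → κ)
    (he : ∀ k, (e ⁻¹' {k}).Finite) {h : ι → A}
    (H : ∀ n i, comp n (g (e i)) = 0 → comp n (h i) = 0) : LocFinite h := fun n =>
  ((hg n).preimage' fun k _ => he k).subset fun i hi hz => hi (H n i hz)

end GradedSums

/-! ### The operator product, treated uniformly for both algebras by a weight filtration. -/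

section Multiplication

variable {A : Type*} [CommRing A] [Algebra ℚ A] [GradedDifferentialAlgebra A]

theorem d_iterate_zsmul (r : ℕ) (c : ℤ) (f : A) :
    (⇑(d (A := A)))^[r] (c • f) = c • (⇑(d (A := A)))^[r] f := by
  induction r with
  | zero => rfl
  | succ r ih => simp only [iterate_succ_apply', ih, map_zsmul]

theorem d_iterate_zero (r : ℕ) : (⇑(d (A := A)))^[r] (0 : A) = 0 :=
  iterate_map_zero _ _

theorem d_iterate_add (r : ℕ) (f g : A) :
    (⇑(d (A := A)))^[r] (f + g) = (⇑(d (A := A)))^[r] f + (⇑(d (A := A)))^[r] g :=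
  iterate_map_add _ _ _ _

theorem d_iterate_mul (n : ℕ) (f g : A) : (⇑(d (A := A)))^[n] (f * g) =
    ∑ p ∈ antidiagonal n, (n.choose p.1 : ℤ) •
      ((⇑(d (A := A)))^[p.1] f * (⇑(d (A := A)))^[p.2] g) := by
  simp only [natCast_zsmul]
  induction n with
  | zero => simp
  | succ n ih =>
    rw [sum_antidiagonal_choose_succ_nsmul
      (fun i j => (⇑(d (A := A)))^[i] f * (⇑(d (A := A)))^[j] g) n]
    simp only [iterate_succ_apply', ih, map_sum, map_nsmul, Derivation.leibniz, smul_add,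
      sum_add_distrib, smul_eq_mul, add_right_inj]
    refine sum_congr rfl fun ⟨i, j⟩ hij => ?_
    rw [n.choose_symm_of_eq_add (HasAntidiagonal.mem_antidiagonal.1 hij).symm, mul_comm]

theorem comp_d_iterate (r n : ℕ) (f : A) :
    comp (n + r) ((⇑(d (A := A)))^[r] f) = (⇑(d (A := A)))^[r] (comp n f) := by
  induction r with
  | zero => rfl
  | succ r ih => rw [iterate_succ_apply', iterate_succ_apply', ← add_assoc, comp_succ_d, ih]

theorem DegGE.d_iterate {k : ℤ} {f : A} (hf : DegGE k f) (r : ℕ) :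
    DegGE (k + r) ((⇑(d (A := A)))^[r] f) := by
  induction r with
  | zero => simpa using hf
  | succ r ih =>
    rw [iterate_succ_apply']
    exact ih.deriv.mono (by push_cast; omega)

theorem exists_of_comp_d_iterate_ne_zero {m r : ℕ} {f : A}
    (h : comp m ((⇑(d (A := A)))^[r] f) ≠ 0) : ∃ b, b + r = m ∧ comp b f ≠ 0 := by
  rcases lt_or_ge m r with hm | hm
  · refine absurd ?_ h
    exact ((degGE_of_nonpos le_rfl f).d_iterate r) m (by omega)
  · refine ⟨m - r, by omega, fun h0 => h ?_⟩
    obtain ⟨n, rfl⟩ : ∃ n, m = n + r := ⟨m - r, by omega⟩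
    rw [comp_d_iterate, show n = n + r - r by omega, h0, d_iterate_zero]

theorem exists_of_comp_mul_ne_zero {m : ℕ} {f g : A} (h : comp m (f * g) ≠ 0) :
    ∃ a b, a + b = m ∧ comp a f ≠ 0 ∧ comp b g ≠ 0 := by
  rw [comp_mul] at h
  obtain ⟨p, hp, hne⟩ := exists_ne_zero_of_sum_ne_zero h
  exact ⟨p.1, p.2, HasAntidiagonal.mem_antidiagonal.1 hp, left_ne_zero_of_mul hne, right_ne_zero_of_mul hne⟩

/-- The weight of the component of degree `j` of the coefficient of `∂^i`. -/
def wt (s : Bool) (i : ℤ) (j : ℕ) : ℤ := if s then i + j else -i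

/-- The operators of weight at least `k`. -/
def Fil (s : Bool) (k : ℤ) (F : Op A) : Prop :=
  ∀ (i : ℤ) (j : ℕ), wt s i j < k → comp j (F i) = 0

/-- Membership in `𝒟⁻` (for `s = false`) or in `𝒟⁺` (for `s = true`). -/
def InAlg (s : Bool) (F : Op A) : Prop := ∃ k, Fil s k F

theorem Fil.le_wt {s : Bool} {k : ℤ} {F : Op A} (hF : Fil s k F) {i : ℤ} {j : ℕ}
    (h : comp j (F i) ≠ 0) : k ≤ wt s i j := by
  by_contra! h'
  exact h (hF i j h')

theorem mem_DMinus_iff {F : Op A} : F ∈ DMinus A ↔ InAlg false F := by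
  constructor
  · rintro ⟨k, hk⟩
    refine ⟨-k, fun i j h => ?_⟩
    rw [hk i (by simp [wt] at h; omega), map_zero]
  · rintro ⟨k, hk⟩
    exact ⟨-k, fun i hi => eq_zero_of_comp fun j => hk i j (by simp [wt]; omega)⟩

theorem mem_DPlus_iff {F : Op A} : F ∈ DPlus A ↔ InAlg true F := by
  constructor
  · rintro ⟨k, hk⟩
    exact ⟨k, fun i j h => hk i j (by simp [wt] at h; omega)⟩
  · rintro ⟨k, hk⟩
    exact ⟨k, fun i j h => hk i j (by simp [wt]; omega)⟩

theorem Fil.mono {s : Bool} {k l : ℤ} {F : Op A} (hF : Fil s k F) (h : l ≤ k) : Fil s l F :=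
  fun i j hij => hF i j (hij.trans_le h)

theorem Fil.add {s : Bool} {k : ℤ} {F G : Op A} (hF : Fil s k F) (hG : Fil s k G) :
    Fil s k (F + G) := fun i j h => by
  rw [Pi.add_apply, map_add, hF i j h, hG i j h, add_zero]

theorem Fil.neg {s : Bool} {k : ℤ} {F : Op A} (hF : Fil s k F) : Fil s k (-F) := fun i j h => by
  rw [Pi.neg_apply, map_neg, hF i j h, neg_zero]

theorem InAlg.add {s : Bool} {F G : Op A} : InAlg s F → InAlg s G → InAlg s (F + G) :=
  fun ⟨k, hk⟩ ⟨l, hl⟩ => ⟨min k l, (hk.mono (min_le_left _ _)).add (hl.mono (min_le_right _ _))⟩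

theorem InAlg.neg {s : Bool} {F : Op A} : InAlg s F → InAlg s (-F) :=
  fun ⟨k, hk⟩ => ⟨k, hk.neg⟩

theorem InAlg.sub {s : Bool} {F G : Op A} (hF : InAlg s F) (hG : InAlg s G) : InAlg s (F - G) := by
  rw [sub_eq_add_neg]
  exact hF.add hG.neg

/-- Each homogeneous piece has a finite weight, so the filtration is separated; equalities can be
proved modulo arbitrarily high weight. -/
theorem eq_zero_of_forall_fil {s : Bool} {F : Op A} (h : ∀ k : ℕ, Fil s k F) : F = 0 :=
  funext fun i => eq_zero_of_comp fun j => h ((wt s i j).toNat + 1) i j (by push_cast; omega)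

theorem fil_monomial (s : Bool) (f : A) (i : ℤ) : Fil s (wt s i 0) (Op.monomial f i) :=
  fun n j h => by
    rw [Op.monomial]
    split_ifs with hn
    · subst hn
      cases s <;> simp [wt] at h
      omega
    · exact map_zero _

theorem inAlg_monomial (s : Bool) (f : A) (i : ℤ) : InAlg s (Op.monomial f i) :=
  ⟨_, fil_monomial s f i⟩

theorem locFinite_mul {s : Bool} {F G : Op A} (hF : InAlg s F) (hG : InAlg s G) (n : ℤ) :
    LocFinite fun p : ℤ × ℕ => F p.1 * (⇑(d (A := A)))^[p.2] (G (n - p.1 + p.2)) := by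
  obtain ⟨k, hk⟩ := hF
  obtain ⟨l, hl⟩ := hG
  intro m
  -- In `min` and `max` the first argument is the bound valid for `s = false`, the second the one
  -- for `s = true`. At most `m` derivatives occur, since each raises the degree by one.
  refine ((Set.finite_Icc (min (n + l) (k - m)) (max (-k) (n + m - l))).prod
    (Set.finite_Iic m)).subset ?_
  rintro ⟨i, r⟩ h
  obtain ⟨a, c, hac, ha, hc⟩ := exists_of_comp_mul_ne_zero h
  obtain ⟨b, hb, hb'⟩ := exists_of_comp_d_iterate_ne_zero hc
  have h1 := hk.le_wt ha
  have h2 := hl.le_wt hb'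
  simp only [Set.mem_prod, Set.mem_Icc, Set.mem_Iic]
  cases s <;> simp only [wt, if_true, Bool.false_eq_true, if_false] at h1 h2 <;> omega

theorem locFinite_mul_mul {s : Bool} {F G H : Op A} (hF : InAlg s F) (hG : InAlg s G)
    (hH : InAlg s H) (n : ℤ) :
    LocFinite fun p : ℤ × ℤ × ℕ × ℕ => F p.1 * ((⇑(d (A := A)))^[p.2.2.1] (G p.2.1) *
      (⇑(d (A := A)))^[p.2.2.2] (H (n - p.1 - p.2.1 + p.2.2.1 + p.2.2.2))) := by
  obtain ⟨k, hk⟩ := hF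
  obtain ⟨l, hl⟩ := hG
  obtain ⟨q, hq⟩ := hH
  intro m
  refine ((Set.finite_Icc (min (n + q + l) (k - m)) (max (-k) (n - l + 2 * m - q))).prod
    ((Set.finite_Icc (min (n + q + k) (l - m)) (max (-l) (n - k + 2 * m - q))).prod
    ((Set.finite_Iic m).prod (Set.finite_Iic m)))).subset ?_
  rintro ⟨i, j, r, t⟩ h
  obtain ⟨a, c, hac, ha, hc⟩ := exists_of_comp_mul_ne_zero h
  obtain ⟨c1, c2, hcc, hc1, hc2⟩ := exists_of_comp_mul_ne_zero hc
  obtain ⟨b1, hb1, hb1'⟩ := exists_of_comp_d_iterate_ne_zero hc1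
  obtain ⟨b2, hb2, hb2'⟩ := exists_of_comp_d_iterate_ne_zero hc2
  have h1 := hk.le_wt ha
  have h2 := hl.le_wt hb1'
  have h3 := hq.le_wt hb2'
  dsimp only at h1 h2 h3 hcc hb1 hb2 hac
  simp only [Set.mem_prod, Set.mem_Icc, Set.mem_Iic]
  cases s <;> simp only [wt, if_true, Bool.false_eq_true, if_false] at h1 h2 h3 <;> omega

/-- A derivative produced by the product lowers the order by one and raises the degree by one: this
leaves order plus degree unchanged and increases minus the order, so neither weight drops. -/
theorem Fil.mul {s : Bool} {k l : ℤ} {F G : Op A} (hF : Fil s k F) (hG : Fil s l G) :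
    Fil s (k + l) (Op.mul F G) := fun n m h => by
  rw [Op.mul, comp_gsum]
  refine finsum_eq_zero_of_forall_eq_zero fun ⟨i, r⟩ => ?_
  rw [map_zsmul]
  by_contra hne
  obtain ⟨a, c, hac, ha, hc⟩ := exists_of_comp_mul_ne_zero (right_ne_zero_of_smul hne)
  obtain ⟨b, hb, hb'⟩ := exists_of_comp_d_iterate_ne_zero hc
  have h1 := hF.le_wt ha
  have h2 := hG.le_wt hb'
  cases s <;> simp only [wt, if_true, Bool.false_eq_true, if_false] at h h1 h2 <;> omega

theorem InAlg.mul {s : Bool} {F G : Op A} : InAlg s F → InAlg s G → InAlg s (Op.mul F G) :=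
  fun ⟨_, hk⟩ ⟨_, hl⟩ => ⟨_, hk.mul hl⟩

/-- The combination of Chu–Vandermonde and trinomial revision behind the associativity of the
product of pseudo-differential operators. -/
theorem sum_choose_mul_choose (i j : ℤ) (r t : ℕ) :
    ∑ p ∈ antidiagonal t,
      Ring.choose i (r + p.1) * Ring.choose j p.2 * ((r + p.1).choose r : ℤ) =
    Ring.choose (i + j - r) t * Ring.choose i r := by
  rw [show i + j - r = (i - r) + j by ring, Ring.add_choose_eq t (Commute.all _ _), sum_mul]
  refine sum_congr rfl fun p _ => ?_
  have h := Ring.choose_smul_choose i (n := r + p.1) (k := r) (by omega)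
  rw [nsmul_eq_mul, Nat.add_sub_cancel_left] at h
  linear_combination (Ring.choose j p.2) * h

/-- The terms of a triple product, indexed by the orders of the first two factors and by the
numbers of derivatives. -/
def tripleTerm (F G H : Op A) (n : ℤ) (p : ℤ × ℤ × ℕ × ℕ × ℕ) : A :=
  (Ring.choose p.1 (p.2.2.1 + p.2.2.2.1) * Ring.choose p.2.1 p.2.2.2.2 *
    ((p.2.2.1 + p.2.2.2.1).choose p.2.2.1 : ℤ)) •
    (F p.1 * ((⇑(d (A := A)))^[p.2.2.1] (G p.2.1) * (⇑(d (A := A)))^[p.2.2.2.1 + p.2.2.2.2]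
      (H (n - p.1 - p.2.1 + p.2.2.1 + (p.2.2.2.1 + p.2.2.2.2 : ℕ)))))

theorem locFinite_tripleTerm {s : Bool} {F G H : Op A} (hF : InAlg s F) (hG : InAlg s G)
    (hH : InAlg s H) (n : ℤ) : LocFinite (tripleTerm F G H n) := by
  refine (locFinite_mul_mul hF hG hH n).of_fibres
    (fun p : ℤ × ℤ × ℕ × ℕ × ℕ => (p.1, p.2.1, p.2.2.1, p.2.2.2.1 + p.2.2.2.2)) ?_ ?_
  · rintro ⟨i, j, r, t⟩
    refine ((Set.finite_singleton i).prod ((Set.finite_singleton j).prod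
      ((Set.finite_singleton r).prod ((Set.finite_Iic t).prod (Set.finite_Iic t))))).subset ?_
    rintro ⟨i', j', r', b, w⟩ h
    simp only [Set.mem_preimage, Set.mem_singleton_iff, Prod.mk.injEq] at h
    simp only [Set.mem_prod, Set.mem_singleton_iff, Set.mem_Iic]
    omega
  · intro m p h
    rw [tripleTerm, map_zsmul, h, smul_zero]

/-- Reindexing by the number of derivatives of the last factor. -/
def tripleEquivLeft : (Σ p : ℤ × ℤ × ℕ × ℕ, antidiagonal p.2.2.2) ≃ ℤ × ℤ × ℕ × ℕ × ℕ where
  toFun p := (p.1.1, p.1.2.1, p.1.2.2.1, p.2.1)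
  invFun p := ⟨(p.1, p.2.1, p.2.2.1, p.2.2.2.1 + p.2.2.2.2), ⟨p.2.2.2, by simp⟩⟩
  left_inv := by
    rintro ⟨⟨i, j, r, t⟩, ⟨⟨a, b⟩, h⟩⟩
    simp only [HasAntidiagonal.mem_antidiagonal] at h
    subst h
    rfl
  right_inv _ := rfl

/-- Reindexing by the number of derivatives of the last two factors. -/
def tripleEquivRight :
    (Σ p : ℤ × ℕ, (ℤ × ℕ) × antidiagonal p.2) ≃ ℤ × ℤ × ℕ × ℕ × ℕ where
  toFun p := (p.1.1, p.2.1.1, p.2.2.1.1, p.2.2.1.2, p.2.1.2)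
  invFun p := ⟨(p.1, p.2.2.1 + p.2.2.2.1), ((p.2.1, p.2.2.2.2), ⟨(p.2.2.1, p.2.2.2.1), by simp⟩)⟩
  left_inv := by
    rintro ⟨⟨i, u⟩, ⟨j, w⟩, ⟨⟨a, b⟩, h⟩⟩
    simp only [HasAntidiagonal.mem_antidiagonal] at h
    subst h
    rfl
  right_inv _ := rfl

/-- Reindexing by the order of the product of the first two factors. -/
def pairEquiv : (ℤ × ℕ) × (ℤ × ℕ) ≃ ℤ × ℤ × ℕ × ℕ where
  toFun p := (p.2.1, p.1.1 - p.2.1 + p.2.2, p.2.2, p.1.2)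
  invFun p := ((p.1 + p.2.1 - p.2.2.1, p.2.2.2), (p.1, p.2.2.1))
  left_inv := by
    rintro ⟨⟨p, s⟩, ⟨i, r⟩⟩
    simp only [Prod.mk.injEq, and_true]
    ring
  right_inv := by
    rintro ⟨i, j, r, s⟩
    simp only [Prod.mk.injEq, and_true, true_and]
    ring

/-- Associativity compares both bracketings with one family. Here the sum over the splittings of the
derivatives falling on `H` is evaluated by `sum_choose_mul_choose`. -/
theorem mul_mul_left_eq {s : Bool} {F G H : Op A} (hF : InAlg s F) (hG : InAlg s G)
    (hH : InAlg s H) (n : ℤ) : Op.mul (Op.mul F G) H n = gsum (tripleTerm F G H n) := by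
  rw [← gsum_comp_equiv tripleEquivLeft,
    gsum_sigma ((locFinite_tripleTerm hF hG hH n).comp_injective tripleEquivLeft.injective)]
  have key : ∀ p : ℤ × ℤ × ℕ × ℕ, (gsum fun j : antidiagonal p.2.2.2 =>
      tripleTerm F G H n (tripleEquivLeft ⟨p, j⟩)) =
      (Ring.choose (p.1 + p.2.1 - p.2.2.1) p.2.2.2 * Ring.choose p.1 p.2.2.1 : ℤ) •
      (F p.1 * ((⇑(d (A := A)))^[p.2.2.1] (G p.2.1) *
      (⇑(d (A := A)))^[p.2.2.2] (H (n - p.1 - p.2.1 + p.2.2.1 + p.2.2.2)))) := by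
    rintro ⟨i, j, r, t⟩
    rw [gsum_fintype, ← sum_choose_mul_choose, sum_smul]
    refine Eq.trans ?_ (sum_coe_sort _ _)
    refine sum_congr rfl fun ⟨⟨b, w⟩, hp⟩ _ => ?_
    simp only [tripleEquivLeft, tripleTerm, Equiv.coe_fn_mk]
    rw [show b + w = t from HasAntidiagonal.mem_antidiagonal.1 hp]
  rw [gsum_congr key]
  refine Eq.trans ?_ (gsum_comp_equiv pairEquiv _)
  refine Eq.trans ?_ (gsum_prod (((locFinite_mul_mul hF hG hH n).zsmul
    fun p => Ring.choose (p.1 + p.2.1 - p.2.2.1) p.2.2.2 * Ring.choose p.1 p.2.2.1).comp_injective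
      pairEquiv.injective)).symm
  refine gsum_congr fun ⟨p, t⟩ => ?_
  rw [Op.mul, gsum_mul _ ((locFinite_mul hF hG p).zsmul _), zsmul_gsum]
  · refine gsum_congr fun ⟨i, r⟩ => ?_
    simp only [pairEquiv, Equiv.coe_fn_mk]
    rw [show i + (p - i + r) - r = p by ring,
      show n - i - (p - i + r) + r + t = n - p + t by ring, smul_mul_assoc, mul_assoc, smul_smul]
  · simp only [mul_comm _ ((⇑(d (A := A)))^[t] (H (n - p + t)))]
    exact ((locFinite_mul hF hG p).zsmul _).mul_left _

/-- For this bracketing the family appears directly, by applying the Leibniz rule to the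
coefficients of the inner product. -/
theorem mul_mul_right_eq {s : Bool} {F G H : Op A} (hF : InAlg s F) (hG : InAlg s G)
    (hH : InAlg s H) (n : ℤ) : Op.mul F (Op.mul G H) n = gsum (tripleTerm F G H n) := by
  have hlf := (locFinite_tripleTerm hF hG hH n).comp_injective tripleEquivRight.injective
  rw [← gsum_comp_equiv tripleEquivRight, gsum_sigma hlf, Op.mul]
  refine gsum_congr fun ⟨i, u⟩ => ?_
  rw [gsum_prod (hlf.comp_injective (e := Sigma.mk (i, u)) sigma_mk_injective), Op.mul]
  have h1 := (locFinite_mul hG hH (n - i + u)).zsmul fun p : ℤ × ℕ => Ring.choose p.1 p.2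
  rw [d_iterate_gsum h1, mul_gsum _ (h1.d_iterate u), zsmul_gsum _ ((h1.d_iterate u).mul_left _)]
  refine gsum_congr fun ⟨j, w⟩ => ?_
  dsimp only
  rw [gsum_fintype, d_iterate_zsmul, d_iterate_mul, smul_sum, mul_sum, smul_sum]
  refine Eq.trans (sum_coe_sort _ _).symm ?_
  refine sum_congr rfl fun ⟨⟨a, b⟩, hp⟩ _ => ?_
  have hu : a + b = u := HasAntidiagonal.mem_antidiagonal.1 hp
  simp only [tripleEquivRight, tripleTerm, Equiv.coe_fn_mk]
  rw [hu, smul_smul, mul_smul_comm, smul_smul, ← iterate_add_apply, ← mul_assoc,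
    show n - i + (u : ℤ) - j + w = n - i - j + a + ((b + w : ℕ) : ℤ) by
      rw [← hu]
      push_cast
      ring]

theorem op_mul_assoc {s : Bool} {F G H : Op A} (hF : InAlg s F) (hG : InAlg s G)
    (hH : InAlg s H) : Op.mul (Op.mul F G) H = Op.mul F (Op.mul G H) :=
  funext fun n => (mul_mul_left_eq hF hG hH n).trans (mul_mul_right_eq hF hG hH n).symm

theorem op_add_mul {s : Bool} {F G H : Op A} (hF : InAlg s F) (hG : InAlg s G)
    (hH : InAlg s H) : Op.mul (F + G) H = Op.mul F H + Op.mul G H := funext fun n => by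
  rw [Pi.add_apply, Op.mul, Op.mul, Op.mul, ← gsum_add ((locFinite_mul hF hH n).zsmul _)
    ((locFinite_mul hG hH n).zsmul _)]
  refine gsum_congr fun p => ?_
  rw [Pi.add_apply, add_mul, smul_add]

theorem op_mul_add {s : Bool} {F G H : Op A} (hF : InAlg s F) (hG : InAlg s G)
    (hH : InAlg s H) : Op.mul F (G + H) = Op.mul F G + Op.mul F H := funext fun n => by
  rw [Pi.add_apply, Op.mul, Op.mul, Op.mul, ← gsum_add ((locFinite_mul hF hG n).zsmul _)
    ((locFinite_mul hF hH n).zsmul _)]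
  refine gsum_congr fun p => ?_
  rw [Pi.add_apply, d_iterate_add, mul_add, smul_add]

theorem op_neg_mul (F G : Op A) : Op.mul (-F) G = -Op.mul F G := funext fun n => by
  rw [Pi.neg_apply, Op.mul, Op.mul, ← gsum_neg]
  exact gsum_congr fun p => by rw [Pi.neg_apply, neg_mul, smul_neg]

theorem op_mul_neg (F G : Op A) : Op.mul F (-G) = -Op.mul F G := funext fun n => by
  rw [Pi.neg_apply, Op.mul, Op.mul, ← gsum_neg]
  refine gsum_congr fun p => ?_
  rw [Pi.neg_apply, ← neg_one_zsmul, d_iterate_zsmul, neg_one_zsmul, mul_neg, smul_neg]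

theorem op_zero_mul (F : Op A) : Op.mul 0 F = 0 := funext fun n => by
  rw [Op.mul]
  exact (gsum_congr fun p => by simp).trans gsum_zero

theorem op_sub_mul {s : Bool} {F G H : Op A} (hF : InAlg s F) (hG : InAlg s G)
    (hH : InAlg s H) : Op.mul (F - G) H = Op.mul F H - Op.mul G H := by
  rw [sub_eq_add_neg, op_add_mul hF hG.neg hH, op_neg_mul, sub_eq_add_neg]

theorem op_mul_sub {s : Bool} {F G H : Op A} (hF : InAlg s F) (hG : InAlg s G)
    (hH : InAlg s H) : Op.mul F (G - H) = Op.mul F G - Op.mul F H := by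
  rw [sub_eq_add_neg, op_mul_add hF hG hH.neg, op_mul_neg, sub_eq_add_neg]

theorem d_iterate_one {r : ℕ} (hr : r ≠ 0) : (⇑(d (A := A)))^[r] (1 : A) = 0 := by
  obtain ⟨r, rfl⟩ := Nat.exists_eq_succ_of_ne_zero hr
  rw [iterate_succ_apply, Derivation.map_one_eq_zero, d_iterate_zero]

theorem mul_monomial_one (F : Op A) (k n : ℤ) : Op.mul F (Op.monomial 1 k) n = F (n - k) := by
  rw [Op.mul, gsum_eq_single (n - k, 0)]
  · simp [Op.monomial]
  · rintro ⟨i, r⟩ h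
    simp only [Op.monomial]
    split_ifs with h'
    · rcases eq_or_ne r 0 with rfl | hr
      · refine absurd ?_ h
        simp only [Prod.mk.injEq, and_true]
        push_cast at h'
        omega
      · rw [d_iterate_one hr, mul_zero, smul_zero]
    · rw [d_iterate_zero, mul_zero, smul_zero]

theorem mul_one_op (F : Op A) : Op.mul F (Op.monomial 1 0) = F :=
  funext fun n => by rw [mul_monomial_one, sub_zero]

theorem monomial_zero_mul (a : A) (F : Op A) : Op.mul (Op.monomial a 0) F = a • F :=
  funext fun n => by
    rw [Op.mul, gsum_eq_single (0, 0)]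
    · simp [Op.monomial]
    · rintro ⟨i, r⟩ h
      simp only [Op.monomial]
      split_ifs with h'
      · subst h'
        have hr : 0 < r := Nat.pos_of_ne_zero fun hr => h (by rw [hr])
        rw [Ring.choose_zero_pos ℤ hr, zero_smul]
      · rw [zero_mul, smul_zero]

theorem one_mul_op (F : Op A) : Op.mul (Op.monomial 1 0) F = F := by
  rw [monomial_zero_mul, one_smul]

theorem d_mul_op (F : Op A) (n : ℤ) :
    Op.mul (Op.monomial 1 1) F n = d (F n) + F (n - 1) := by
  rw [Op.mul, gsum_eq_sum {((1 : ℤ), 0), (1, 1)}]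
  · rw [sum_pair (by simp)]
    simp [Op.monomial, add_comm]
  · rintro ⟨i, r⟩ h
    simp only [Op.monomial]
    split_ifs with h'
    · subst h'
      have hr : 1 < r := by
        simp only [mem_insert, Prod.mk.injEq, true_and, mem_singleton] at h
        omega
      have := Ring.choose_natCast (R := ℤ) 1 r
      rw [Nat.choose_eq_zero_of_lt hr] at this
      rw [show Ring.choose (1 : ℤ) r = 0 by simpa using this, zero_smul]
    · rw [zero_mul, smul_zero]

theorem monomial_mul_monomial_one (f : A) (i j : ℤ) :
    Op.mul (Op.monomial f i) (Op.monomial 1 j) = Op.monomial f (i + j) := funext fun n => by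
  rw [mul_monomial_one, Op.monomial, Op.monomial]
  exact if_congr (by omega) rfl rfl

theorem InAlg.derOp {s : Bool} {F : Op A} (hF : InAlg s F) (T : TimeFlows A) (σ : Time) :
    InAlg s (T.derOp σ F) :=
  let ⟨k, hk⟩ := hF
  ⟨k, fun i j hij => T.degGE σ (j + 1) (F i) (fun j' hj' => hk i j' (by
    cases s <;> simp only [wt, if_true, Bool.false_eq_true, if_false] at hij ⊢ <;> omega)) j
      (by omega)⟩

theorem op_mul_intCast_smul {s : Bool} {F G : Op A} (hF : InAlg s F) (hG : InAlg s G) (c : ℤ) :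
    Op.mul F ((c : A) • G) = (c : A) • Op.mul F G := funext fun n => by
  rw [Pi.smul_apply, smul_eq_mul, ← zsmul_eq_mul, Op.mul, Op.mul,
    zsmul_gsum _ ((locFinite_mul hF hG n).zsmul _)]
  refine gsum_congr fun p => ?_
  rw [Pi.smul_apply, smul_eq_mul, ← zsmul_eq_mul, d_iterate_zsmul, mul_smul_comm, smul_comm]

/-- Leibniz rule for a derivation commuting with `∂`. -/
theorem derOp_mul (T : TimeFlows A) (σ : Time) {s : Bool} {F G : Op A} (hF : InAlg s F)
    (hG : InAlg s G) : T.derOp σ (Op.mul F G) =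
      Op.mul (T.derOp σ F) G + Op.mul F (T.derOp σ G) := funext fun n => by
  have hfil : Filtered (T.der σ : A →ₗ[ℚ] A) := T.degGE σ
  have hd : ∀ (r : ℕ) (f : A),
      T.der σ ((⇑(d (A := A)))^[r] f) = (⇑(d (A := A)))^[r] (T.der σ f) := fun r f => by
    induction r with
    | zero => rfl
    | succ r ih => rw [iterate_succ_apply', iterate_succ_apply', ← ih, ← T.der_x, T.comm]
  change T.der σ (Op.mul F G n) = Op.mul _ _ n + Op.mul _ _ n
  rw [Op.mul, Op.mul, Op.mul, ← gsum_add ((locFinite_mul (hF.derOp T σ) hG n).zsmul _)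
    ((locFinite_mul hF (hG.derOp T σ) n).zsmul _)]
  refine (hfil.map_gsum ((locFinite_mul hF hG n).zsmul _)).trans (gsum_congr fun p => ?_)
  simp only [Derivation.coeFn_coe, map_zsmul, Derivation.leibniz, hd, smul_eq_mul,
    TimeFlows.derOp]
  rw [← smul_add, add_comm, mul_comm (T.der σ (F p.1))]

end Multiplication

/-! ### Inverses from Neumann series. -/

section Inverses

variable {A : Type*} [CommRing A] [Algebra ℚ A] [GradedDifferentialAlgebra A]

theorem fil_one (s : Bool) : Fil s 0 (Op.monomial (1 : A) 0) := by
  have h := fil_monomial s (1 : A) 0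
  cases s <;> simpa [wt] using h

/-- `F` has no negative powers of `∂`. -/
def NonNeg (F : Op A) : Prop := ∀ n < 0, F n = 0

theorem choose_eq_zero {i : ℤ} {r : ℕ} (h0 : 0 ≤ i) (h : i < r) : Ring.choose i r = 0 := by
  lift i to ℕ using h0
  rw [Ring.choose_natCast, Nat.choose_eq_zero_of_lt (by omega), Nat.cast_zero]

/-- From orders i, j ≥ 0 a negative order i + j - r needs r > i, where the binomial coefficient
vanishes. -/
theorem NonNeg.mul {F G : Op A} (hF : NonNeg F) (hG : NonNeg G) : NonNeg (Op.mul F G) :=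
  fun n hn => by
    rw [Op.mul]
    refine (gsum_congr fun ⟨i, r⟩ => ?_).trans gsum_zero
    dsimp only
    rcases lt_or_ge i 0 with hi | hi
    · rw [hF i hi, zero_mul, smul_zero]
    rcases lt_or_ge (n - i + r) 0 with hj | hj
    · rw [hG _ hj, d_iterate_zero, mul_zero, smul_zero]
    · rw [choose_eq_zero hi (by omega), zero_smul]

/-- The partial sums of the Neumann series of `(1 + B)⁻¹`. -/
noncomputable def neumann (B : Op A) : ℕ → Op A
  | 0 => 0
  | N + 1 => Op.monomial 1 0 - Op.mul B (neumann B N)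

theorem fil_zero (s : Bool) (k : ℤ) : Fil s k (0 : Op A) := fun _ _ _ => map_zero _

theorem fil_neumann {s : Bool} {B : Op A} (hB : Fil s 1 B) (N : ℕ) : Fil s 0 (neumann B N) := by
  induction N with
  | zero => exact fil_zero s 0
  | succ N ih =>
    rw [neumann, sub_eq_add_neg]
    exact (fil_one s).add ((hB.mul ih).mono (by omega)).neg

/-- Each difference of consecutive partial sums is `-B` times the preceding one, so its weight grows
by one per step. -/
theorem fil_neumann_succ_sub {s : Bool} {B : Op A} (hB : Fil s 1 B) (N : ℕ) :
    Fil s N (neumann B (N + 1) - neumann B N) := by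
  induction N with
  | zero =>
    rw [show neumann B 0 = 0 from rfl, sub_zero]
    exact fil_neumann hB 1
  | succ N ih =>
    have h : neumann B (N + 1 + 1) - neumann B (N + 1) =
        -Op.mul B (neumann B (N + 1) - neumann B N) := by
      rw [op_mul_sub ⟨_, hB⟩ ⟨_, fil_neumann hB _⟩ ⟨_, fil_neumann hB _⟩, neumann, neumann]
      abel
    rw [h]
    exact ((hB.mul ih).mono (by push_cast; omega)).neg

theorem fil_neumann_sub {s : Bool} {B : Op A} (hB : Fil s 1 B) {M N : ℕ} (h : M ≤ N) :
    Fil s M (neumann B N - neumann B M) := by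
  induction N, h using Nat.le_induction with
  | base => simpa using fil_zero s M
  | succ N hN ih =>
    rw [← sub_add_sub_cancel _ (neumann B N)]
    exact ((fil_neumann_succ_sub hB N).mono (by omega)).add ih

/-- The partial sums stabilise in every weight, and completeness of `A` assembles the limit. The
absence of negative orders is carried along because the weight filtration for `s = true` does not
detect it. -/
theorem exists_right_inv {s : Bool} {B : Op A} (hB : Fil s 1 B) :
    ∃ S : Op A, Fil s 0 S ∧ S + Op.mul B S = Op.monomial 1 0 ∧ (NonNeg B → NonNeg S) := by
  -- A piece of weight w no longer changes once the index of the partial sum exceeds w.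
  choose S hS _ using fun n : ℤ => GradedDifferentialAlgebra.complete
    (fun j => neumann B ((wt s n j).toNat + 1) n)
  have hlim : ∀ N : ℕ, Fil s N (S - neumann B N) := fun N i j hij => by
    rw [Pi.sub_apply, map_sub, hS]
    rcases le_total N ((wt s i j).toNat + 1) with h | h
    · rw [← map_sub]
      exact fil_neumann_sub hB h i j hij
    · rw [← neg_eq_zero, neg_sub, ← map_sub]
      exact fil_neumann_sub hB h i j (by push_cast; omega)
  have hS0 : Fil s 0 S := by simpa [neumann] using hlim 0
  refine ⟨S, hS0, ?_, fun hpos n hn => eq_zero_of_comp fun j => ?_⟩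
  · rw [← sub_eq_zero]
    refine eq_zero_of_forall_fil (s := s) fun N => ?_
    have h : S + Op.mul B S - Op.monomial 1 0 = (S - neumann B N) + Op.mul B (S - neumann B N) +
        -(neumann B (N + 1) - neumann B N) := by
      rw [op_mul_sub ⟨_, hB⟩ ⟨_, hS0⟩ ⟨_, fil_neumann hB _⟩, neumann]
      abel
    rw [h]
    exact ((hlim N).add ((hB.mul (hlim N)).mono (by omega))).add (fil_neumann_succ_sub hB N).neg
  · have h : ∀ N, NonNeg (neumann B N) := fun N => by
      induction N with
      | zero => exact fun _ _ => rfl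
      | succ N ih =>
        intro m hm
        rw [neumann, Pi.sub_apply, hpos.mul ih m hm, sub_zero, Op.monomial, if_neg hm.ne]
    rw [hS, h _ n hn, map_zero]

theorem inv_unique {s : Bool} {F G H : Op A} (hF : InAlg s F) (hG : InAlg s G) (hH : InAlg s H)
    (hGF : Op.mul G F = Op.monomial 1 0) (hFH : Op.mul F H = Op.monomial 1 0) : G = H := by
  rw [← mul_one_op G, ← hFH, ← op_mul_assoc hG hF hH, hGF, one_mul_op]

/-- A right inverse `S` of `1 + B` is again 1 plus weight at least one, so it has a right inverse
too. The latter must be `1 + B`, which makes `S` two-sided. -/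
theorem exists_inv_one_add {s : Bool} {B : Op A} (hB : Fil s 1 B) :
    ∃ S : Op A, Fil s 0 S ∧ Fil s 1 (S - Op.monomial 1 0) ∧
      Op.mul (Op.monomial 1 0 + B) S = Op.monomial 1 0 ∧
      Op.mul S (Op.monomial 1 0 + B) = Op.monomial 1 0 ∧ (NonNeg B → NonNeg S) := by
  have hone : ∀ {B : Op A}, Fil s 1 B → InAlg s (Op.monomial 1 0 + B) := fun h =>
    InAlg.add ⟨_, fil_one s⟩ ⟨_, h⟩
  have hadd : ∀ {B S : Op A}, Fil s 1 B → Fil s 0 S → S + Op.mul B S = Op.monomial 1 0 →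
      Op.mul (Op.monomial 1 0 + B) S = Op.monomial 1 0 := fun h1 h2 h => by
    rw [op_add_mul ⟨_, fil_one s⟩ ⟨_, h1⟩ ⟨_, h2⟩, one_mul_op, h]
  obtain ⟨S, hS, hBS, hpos⟩ := exists_right_inv hB
  have hS1 : Fil s 1 (S - Op.monomial 1 0) := by
    rw [← hBS, sub_add_cancel_left]
    exact ((hB.mul hS).mono (by omega)).neg
  obtain ⟨S', hS', hBS', -⟩ := exists_right_inv hS1
  have h1 := hadd hB hS hBS
  have h2 := hadd hS1 hS' hBS'
  rw [add_sub_cancel] at h2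
  have h3 := inv_unique ⟨_, hS⟩ (hone hB) ⟨_, hS'⟩ h1 h2
  exact ⟨S, hS, hS1, h1, h3 ▸ h2, hpos⟩

theorem op_inv_eq {s : Bool} {S : Set (Op A)} (hS : ∀ F, F ∈ S ↔ InAlg s F) {F G : Op A}
    (hF : InAlg s F) (hG : InAlg s G) (h1 : Op.mul F G = Op.monomial 1 0)
    (h2 : Op.mul G F = Op.monomial 1 0) : Op.inv S F = G := by
  have h : ∃ G ∈ S, Op.mul F G = Op.monomial 1 0 ∧ Op.mul G F = Op.monomial 1 0 :=
    ⟨G, (hS G).2 hG, h1, h2⟩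
  rw [Op.inv, dif_pos h]
  obtain ⟨hm, h3, -⟩ := Classical.choose_spec h
  exact (inv_unique hF hG ((hS _).1 hm) h2 h3).symm

/-- This is the geometric series in `f - 1`, read off from the operator of order zero with
coefficient `f`. It provides the invertibility of ρ. -/
theorem isUnit_of_degGE_one {f : A} (h : DegGE 1 (f - 1)) : IsUnit f := by
  have hB : Fil true 1 (Op.monomial (f - 1) 0) := fun i j hij => by
    rw [Op.monomial]
    split_ifs with hi
    · exact h j (by simpa [wt, hi] using hij)
    · exact map_zero _
  obtain ⟨S, -, -, hS, -⟩ := exists_inv_one_add hB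
  have hf : Op.monomial 1 0 + Op.monomial (f - 1) 0 = Op.monomial f 0 := funext fun n => by
    simp only [Op.monomial, Pi.add_apply]
    split_ifs <;> ring
  rw [hf, monomial_zero_mul] at hS
  refine IsUnit.of_mul_eq_one (S 0) ?_
  simpa [Op.monomial] using congrFun hS 0

theorem inAlg_of_nonNeg {F : Op A} (hF : NonNeg F) : InAlg true F :=
  ⟨0, fun i j h => by rw [hF i (by simp [wt] at h; omega), map_zero]⟩

end Inverses

/-! ### The dressing operators and their inverses. -/

namespace Dressing

variable {A : Type*} [CommRing A] (S : Dressing A)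

theorem phi_zero : S.Phi 0 = 1 := rfl

theorem phi_of_pos {n : ℤ} (hn : 0 < n) : S.Phi n = 0 := by
  obtain ⟨k, rfl⟩ : ∃ k : ℕ, n = Int.ofNat (k + 1) := ⟨n.toNat - 1, by simp; omega⟩
  rfl

theorem phiHat_zero : S.PhiHat 0 = S.expf := mul_one _

theorem phiHat_nonNeg : NonNeg S.PhiHat := fun n hn => by
  obtain ⟨k, rfl⟩ : ∃ k : ℕ, n = Int.negSucc k := ⟨(-n).toNat - 1, by omega⟩
  exact mul_zero _

variable [Algebra ℚ A] [GradedDifferentialAlgebra A]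

theorem fil_phi_sub : Fil false 1 (S.Phi - Op.monomial 1 0) := fun i j h => by
  simp only [wt, Bool.false_eq_true, if_false] at h
  rcases eq_or_ne i 0 with rfl | hi
  · simp [S.phi_zero, Op.monomial]
  · simp [S.phi_of_pos (show 0 < i by omega), Op.monomial, hi]

theorem inAlg_phi : InAlg false S.Phi := by
  have h := InAlg.add (s := false) ⟨_, S.fil_phi_sub⟩ ⟨_, fil_one false⟩
  rwa [sub_add_cancel] at h

theorem exists_phiInv : InAlg false S.PhiInv ∧ Op.mul S.Phi S.PhiInv = Op.monomial 1 0 ∧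
    Op.mul S.PhiInv S.Phi = Op.monomial 1 0 ∧ Fil false 1 (S.PhiInv - Op.monomial 1 0) := by
  obtain ⟨G, h0, h1, h2, h3, -⟩ := exists_inv_one_add S.fil_phi_sub
  rw [add_sub_cancel] at h2 h3
  rw [PhiInv, op_inv_eq (fun _ => mem_DMinus_iff) S.inAlg_phi ⟨_, h0⟩ h2 h3]
  exact ⟨⟨_, h0⟩, h2, h3, h1⟩

theorem inAlg_phiInv : InAlg false S.PhiInv := S.exists_phiInv.1

theorem phi_mul_phiInv : Op.mul S.Phi S.PhiInv = Op.monomial 1 0 := S.exists_phiInv.2.1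

theorem phiInv_mul_phi : Op.mul S.PhiInv S.Phi = Op.monomial 1 0 := S.exists_phiInv.2.2.1

theorem phiInv_of_pos {n : ℤ} (hn : 0 < n) : S.PhiInv n = 0 := eq_zero_of_comp fun j => by
  simpa [Op.monomial, hn.ne'] using
    S.exists_phiInv.2.2.2 n j (by simp only [wt, Bool.false_eq_true, if_false]; omega)

theorem phiInv_zero : S.PhiInv 0 = 1 := sub_eq_zero.1 <| eq_zero_of_comp fun j => by
  simpa [Op.monomial] using S.exists_phiInv.2.2.2 0 j (by simp [wt])

theorem inAlg_phiHat : InAlg true S.PhiHat := inAlg_of_nonNeg S.phiHat_nonNeg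

/-- After division by e^f what is left is 1 plus strictly positive orders, hence 1 plus weight at
least one. The inverse has no negative orders, which fails for general elements of 𝒟⁺ and is used
constantly below. -/
theorem exists_phiHatInv : NonNeg S.PhiHatInv ∧ Op.mul S.PhiHat S.PhiHatInv = Op.monomial 1 0 ∧
    Op.mul S.PhiHatInv S.PhiHat = Op.monomial 1 0 := by
  set e : Op A := Op.monomial (S.expf : A) 0
  set e' : Op A := Op.monomial ((S.expf⁻¹ : Aˣ) : A) 0
  have he : InAlg true e := inAlg_monomial _ _ _
  have he' : InAlg true e' := inAlg_monomial _ _ _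
  have hee : Op.mul e e' = Op.monomial 1 0 := by
    simp only [e, e', monomial_zero_mul]
    funext n
    simp [Op.monomial]
  have hee' : Op.mul e' e = Op.monomial 1 0 := by
    simp only [e, e', monomial_zero_mul]
    funext n
    simp [Op.monomial]
  set B : Op A := Op.mul e' S.PhiHat - Op.monomial 1 0
  have hBa : ∀ n, B n = nonnegSeries 0 S.b n := fun n => by
    simp only [B, e', monomial_zero_mul, Pi.sub_apply, Pi.smul_apply, PhiHat, smul_eq_mul,
      Units.inv_mul_cancel_left]
    match n with
    | Int.ofNat 0 => simp [Op.monomial, nonnegSeries]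
    | Int.ofNat (n + 1) =>
      have : ((n : ℤ) + 1) ≠ 0 := by omega
      simp [Op.monomial, nonnegSeries, this]
    | Int.negSucc n => simp [Op.monomial, nonnegSeries]
  have hB0 : ∀ n ≤ 0, B n = 0 := fun n hn => by
    rw [hBa]
    match n, hn with
    | Int.ofNat 0, _ => rfl
    | Int.negSucc n, _ => rfl
  have hB : Fil true 1 B := fun i j h => by rw [hB0 i (by simp [wt] at h; omega), map_zero]
  have hBe : S.PhiHat = Op.mul e (Op.monomial 1 0 + B) := by
    rw [add_sub_cancel, ← op_mul_assoc he he' S.inAlg_phiHat, hee, one_mul_op]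
  obtain ⟨G, h0, -, h2, h3, h4⟩ := exists_inv_one_add hB
  have hG : NonNeg G := h4 fun n hn => hB0 n hn.le
  have hGa : InAlg true G := ⟨_, h0⟩
  have hBa : InAlg true (Op.monomial 1 0 + B) := InAlg.add ⟨_, fil_one _⟩ ⟨_, hB⟩
  have hpos : NonNeg (Op.mul G e') := hG.mul fun n hn => if_neg hn.ne
  have h5 : Op.mul S.PhiHat (Op.mul G e') = Op.monomial 1 0 := by
    rw [hBe, op_mul_assoc he hBa (hGa.mul he'), ← op_mul_assoc hBa hGa he', h2, one_mul_op, hee]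
  have h6 : Op.mul (Op.mul G e') S.PhiHat = Op.monomial 1 0 := by
    rw [hBe, op_mul_assoc hGa he' (he.mul hBa), ← op_mul_assoc he' he hBa, hee', one_mul_op, h3]
  rw [PhiHatInv, op_inv_eq (fun _ => mem_DPlus_iff) S.inAlg_phiHat (hGa.mul he') h5 h6]
  exact ⟨hpos, h5, h6⟩

theorem phiHatInv_nonNeg : NonNeg S.PhiHatInv := S.exists_phiHatInv.1

theorem inAlg_phiHatInv : InAlg true S.PhiHatInv := inAlg_of_nonNeg S.phiHatInv_nonNeg

theorem phiHat_mul_phiHatInv : Op.mul S.PhiHat S.PhiHatInv = Op.monomial 1 0 :=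
  S.exists_phiHatInv.2.1

theorem phiHatInv_mul_phiHat : Op.mul S.PhiHatInv S.PhiHat = Op.monomial 1 0 :=
  S.exists_phiHatInv.2.2

end Dressing

/-! ### The residue pairing of half-infinite series. -/

section HalfInfinite

variable {A : Type*} [CommRing A]

/-- The series `∑ u_i z^i` has no terms with `i > -k` (for `s = false`), or with `i < k` (for
`s = true`). -/
def Half (s : Bool) (k : ℤ) (u : ℤ → A) : Prop := ∀ i, (if s then i else -i) < k → u i = 0

/-- Being bounded above (for `s = false`) or below (for `s = true`). -/
def HalfBdd (s : Bool) (u : ℤ → A) : Prop := ∃ k, Half s k u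

theorem HalfBdd.of_support {s : Bool} {u v : ℤ → A} (hu : HalfBdd s u)
    (h : ∀ i, u i = 0 → v i = 0) : HalfBdd s v :=
  let ⟨k, hk⟩ := hu
  ⟨k, fun i hi => h i (hk i hi)⟩

theorem HalfBdd.add {s : Bool} {u v : ℤ → A} : HalfBdd s u → HalfBdd s v → HalfBdd s (u + v) :=
  fun ⟨k, hk⟩ ⟨l, hl⟩ => ⟨min k l, fun i hi => by
    rw [Pi.add_apply, hk i (by omega), hl i (by omega), add_zero]⟩

theorem HalfBdd.smul {s : Bool} {u : ℤ → A} (hu : HalfBdd s u) (a : A) : HalfBdd s (a • u) :=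
  hu.of_support fun i hi => by rw [Pi.smul_apply, hi, smul_zero]

theorem HalfBdd.shift {s : Bool} {u : ℤ → A} (hu : HalfBdd s u) (p : ℤ) :
    HalfBdd s fun n => u (n - p) := by
  obtain ⟨k, hk⟩ := hu
  refine ⟨k + if s then p else -p, fun i hi => hk _ ?_⟩
  cases s <;> simp only [if_true, Bool.false_eq_true, if_false] at hi ⊢ <;> omega

/-- The residue of the product of two series. -/
noncomputable def pair (u v : ℤ → A) : A := ∑ᶠ i, u i * v (-1 - i)

theorem finite_support_pair {s : Bool} {u v : ℤ → A} (hu : HalfBdd s u) (hv : HalfBdd s v) :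
    (support fun i => u i * v (-1 - i)).Finite := by
  obtain ⟨k, hk⟩ := hu
  obtain ⟨l, hl⟩ := hv
  refine (Set.finite_Icc (min k (l - 1)) (max (-k) (-1 - l))).subset fun i hi => ?_
  have h1 := mt (hk i) (left_ne_zero_of_mul hi)
  have h2 := mt (hl _) (right_ne_zero_of_mul hi)
  rw [Set.mem_Icc]
  cases s <;> simp only [if_true, Bool.false_eq_true, if_false] at h1 h2 <;> omega

theorem pair_add_left {s : Bool} {u u' v : ℤ → A} (hu : HalfBdd s u) (hu' : HalfBdd s u')
    (hv : HalfBdd s v) : pair (u + u') v = pair u v + pair u' v := by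
  rw [pair, pair, pair, ← finsum_add_distrib (finite_support_pair hu hv)
    (finite_support_pair hu' hv)]
  exact finsum_congr fun i => by rw [Pi.add_apply, add_mul]

theorem pair_add_right {s : Bool} {u v v' : ℤ → A} (hu : HalfBdd s u) (hv : HalfBdd s v)
    (hv' : HalfBdd s v') : pair u (v + v') = pair u v + pair u v' := by
  rw [pair, pair, pair, ← finsum_add_distrib (finite_support_pair hu hv)
    (finite_support_pair hu hv')]
  exact finsum_congr fun i => by rw [Pi.add_apply, mul_add]

theorem pair_smul_left {s : Bool} {u v : ℤ → A} (hu : HalfBdd s u) (hv : HalfBdd s v) (a : A) :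
    pair (a • u) v = a * pair u v := by
  rw [pair, pair, mul_finsum' (h := finite_support_pair hu hv)]
  exact finsum_congr fun i => by rw [Pi.smul_apply, smul_eq_mul, mul_assoc]

theorem pair_smul_right {s : Bool} {u v : ℤ → A} (hu : HalfBdd s u) (hv : HalfBdd s v) (a : A) :
    pair u (a • v) = a * pair u v := by
  rw [pair, pair, mul_finsum' (h := finite_support_pair hu hv)]
  exact finsum_congr fun i => by rw [Pi.smul_apply, smul_eq_mul, mul_left_comm]

theorem pair_shift (u v : ℤ → A) (p : ℤ) :
    pair (fun n => u (n - p)) v = pair u fun n => v (n - p) := by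
  rw [pair, pair, ← finsum_comp_equiv (Equiv.addRight p)]
  refine finsum_congr fun i => ?_
  simp only [Equiv.coe_addRight, add_sub_cancel_right]
  congr 2
  ring

end HalfInfinite

/-! ### Time derivatives of wave functions and the pairing. -/

section Flows

variable {A : Type*} [CommRing A] [Algebra ℚ A] [GradedDifferentialAlgebra A]

/-- The coefficients of the `σ`-derivative of the wave function `(∑ v_i z^i) e^χ`. -/
def TimeFlows.flow (T : TimeFlows A) (χ : Phase) (σ : Time) (v : ℤ → A) : ℤ → A :=
  T.derOp σ v + (χ.coeff σ : A) • fun n => v (n - χ.pow σ)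

/-- Iterated derivatives of a wave function. -/
def TimeFlows.flows (T : TimeFlows A) (χ : Phase) (w : List Time) (v : ℤ → A) : ℤ → A :=
  w.foldr (T.flow χ) v

variable (T : TimeFlows A) (χ : Phase)

theorem flow_apply (σ : Time) (v : ℤ → A) (n : ℤ) :
    T.flow χ σ v n = T.der σ (v n) + χ.coeff σ * v (n - χ.pow σ) := rfl

theorem HalfBdd.derOp {s : Bool} {v : ℤ → A} (hv : HalfBdd s v) (σ : Time) :
    HalfBdd s (T.derOp σ v) :=
  hv.of_support fun i hi => by rw [TimeFlows.derOp, hi, map_zero]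

theorem HalfBdd.flow {s : Bool} {v : ℤ → A} (hv : HalfBdd s v) (σ : Time) :
    HalfBdd s (T.flow χ σ v) :=
  (hv.derOp T σ).add ((hv.shift _).smul _)

theorem HalfBdd.flows {s : Bool} {v : ℤ → A} (hv : HalfBdd s v) (w : List Time) :
    HalfBdd s (T.flows χ w v) := by
  induction w with
  | nil => exact hv
  | cons σ w ih => exact ih.flow T χ σ

theorem der_pair {s : Bool} {u v : ℤ → A} (hu : HalfBdd s u) (hv : HalfBdd s v) (σ : Time) :
    T.der σ (pair u v) = pair (T.derOp σ u) v + pair u (T.derOp σ v) := by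
  rw [pair, pair, pair, ← finsum_add_distrib (finite_support_pair (hu.derOp T σ) hv)
    (finite_support_pair hu (hv.derOp T σ)), map_finsum _ (finite_support_pair hu hv)]
  refine finsum_congr fun i => ?_
  rw [Derivation.leibniz, smul_eq_mul, smul_eq_mul, TimeFlows.derOp, TimeFlows.derOp, add_comm,
    mul_comm (v _)]

/-- Opposite exponentials cancel in the product: the two shift terms are equal up to sign by
`pair_shift`, and the plain product rule remains. -/
theorem der_pair_flow {s : Bool} {u v : ℤ → A} (hu : HalfBdd s u) (hv : HalfBdd s v)
    (σ : Time) : T.der σ (pair u v) =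
      pair (T.flow χ σ u) v + pair u (T.flow (χ.smul (-1)) σ v) := by
  rw [TimeFlows.flow, TimeFlows.flow, pair_add_left (hu.derOp T σ) ((hu.shift _).smul _) hv,
    pair_add_right hu (hv.derOp T σ) ((hv.shift _).smul _), der_pair T hu hv,
    pair_smul_left (hu.shift _) hv, pair_smul_right hu (hv.shift _), pair_shift]
  simp only [Phase.smul, Units.val_neg, Units.val_one]
  push_cast
  ring

/-- The residue of a product of operators in terms of the formal adjoint of the second one. -/
theorem mul_apply_neg_one {s t : Bool} {F X : Op A} (hF : InAlg s F) (hX : InAlg s X)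
    (hFt : HalfBdd t F) (hXt : HalfBdd t (X.adjoint.applyExp (-1) χ).coeff) :
    Op.mul F X (-1) = pair F (X.adjoint.applyExp (-1) χ).coeff := by
  rw [Op.mul, gsum_prod ((locFinite_mul hF hX (-1)).zsmul _), pair,
    ← gsum_eq_finsum (finite_support_pair hFt hXt)]
  refine gsum_congr fun i => ?_
  have h1 : InAlg s (Op.monomial (1 : A) i) := inAlg_monomial s 1 i
  have hlf : LocFinite fun r : ℕ => (⇑(d (A := A)))^[r] (X (-1 - i + r)) := by
    have h := (locFinite_mul h1 hX (-1)).comp_injective (e := fun r : ℕ => (i, r))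
      (Prod.mk_right_injective i)
    simpa [Op.monomial] using h
  -- Upper negation of the binomial coefficient, binom(i, r) = (-1)^r binom(r - 1 - i, r), absorbs
  -- the signs of the adjoint and of the exponential.
  have hc : ∀ r : ℕ, (((-1 : ℤˣ) ^ (-1 - i) : ℤˣ) : ℤ) *
      ((((-1 : ℤˣ) ^ (-1 - i + r) : ℤˣ) : ℤ) * Ring.choose (-1 - i + r) r) = Ring.choose i r := by
    intro r
    have h := Ring.choose_neg (-i) r
    rw [neg_neg, Units.smul_def, smul_eq_mul, show -i + (r : ℤ) - 1 = -1 - i + r by ring] at h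
    rw [h, ← mul_assoc, ← Units.val_mul, ← zpow_add, Int.negOnePow_def]
    congr 2
    rw [show -1 - i + (-1 - i + (r : ℤ)) = r + 2 * (-1 - i) by ring, zpow_add, zpow_mul]
    simp
  simp only [Op.applyExp, Op.adjoint]
  rw [zsmul_gsum]
  · rw [mul_gsum]
    · refine gsum_congr fun r => ?_
      rw [smul_smul, smul_smul, mul_assoc, hc, mul_smul_comm]
    · simp only [smul_smul]
      exact hlf.zsmul _
  · simp only [smul_smul]
    exact hlf.zsmul _

end Flows

/-! ### Derivatives of the exponential series. -/

section Exponentials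

/-- The recursion of divided powers, serving both the exponential (`g` the phase coefficients) and
Taylor's formula (`g = 1`). -/
theorem prod_factorial_add_single (m : Time →₀ ℕ) (σ : Time) (g : Time → ℚ) :
    ((m + Finsupp.single σ 1).prod fun τ e => g τ ^ e / (e.factorial : ℚ)) * (m σ + 1) =
      g σ * m.prod fun τ e => g τ ^ e / (e.factorial : ℚ) := by
  classical
  have hs : m.support ⊆ insert σ m.support := subset_insert _ _
  have hs' : (m + Finsupp.single σ 1).support ⊆ insert σ m.support := by
    intro τ hτ
    simp only [Finsupp.mem_support_iff, Finsupp.add_apply, Finsupp.single_apply, mem_insert] at hτ ⊢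
    by_contra! h
    simp [h.2, h.1.symm] at hτ
  rw [Finsupp.prod_of_support_subset _ hs' _ (by simp), Finsupp.prod_of_support_subset _ hs _
    (by simp), ← mul_prod_erase _ _ (mem_insert_self σ _), ← mul_prod_erase _ _
    (mem_insert_self σ _)]
  have h : ∀ τ ∈ (insert σ m.support).erase σ,
      (m + Finsupp.single σ 1 : Time →₀ ℕ) τ = m τ := fun τ hτ => by
    have := Finset.ne_of_mem_erase hτ
    simp [this.symm]
  rw [prod_congr rfl fun τ hτ => by rw [h τ hτ]]
  have h1 : ((m σ).factorial : ℚ) ≠ 0 := by exact_mod_cast (m σ).factorial_ne_zero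
  have h2 : (m σ + 1 : ℚ) ≠ 0 := by positivity
  simp only [Finsupp.add_apply, Finsupp.single_eq_same, Nat.factorial_succ]
  push_cast
  field_simp
  ring

theorem pderiv_expCoeff {A : Type*} [CommRing A] [Algebra ℚ A] (χ : Phase) (σ : Time) (n : ℤ) :
    MvPowerSeries.pderiv A σ (χ.expCoeff A n) =
      MvPowerSeries.C (χ.coeff σ : A) * χ.expCoeff A (n - χ.pow σ) := by
  ext m
  rw [MvPowerSeries.coeff_pderiv, MvPowerSeries.coeff_C_mul]
  simp only [MvPowerSeries.coeff_apply, Phase.expCoeff]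
  have hw : ((m + Finsupp.single σ 1).sum fun τ e => (e : ℤ) * χ.pow τ) =
      (m.sum fun τ e => (e : ℤ) * χ.pow τ) + χ.pow σ := by
    classical
    rw [Finsupp.sum_add_index' (by simp) (by intros; push_cast; ring)]
    simp
  rw [hw]
  have h := congrArg (algebraMap ℚ A)
    (prod_factorial_add_single m σ fun τ => (χ.coeff τ : ℚ))
  simp only [map_mul, map_add, map_natCast, map_one, map_intCast] at h
  by_cases hn : (m.sum fun τ e => (e : ℤ) * χ.pow τ) + χ.pow σ = n
  · rw [if_pos hn, if_pos (by omega), h]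
  · rw [if_neg hn, if_neg (by omega), zero_mul, mul_zero]

end Exponentials

/-! ### Taylor coefficients of the bilinear residue. -/

section Residues

variable {A : Type*} [CommRing A] [Algebra ℚ A] [GradedDifferentialAlgebra A]
variable (T : TimeFlows A) (χ : Phase)

theorem mixed_zero (f : A) : T.mixed 0 f = f := by
  simp [TimeFlows.mixed]

theorem mixed_add_single (m : Time →₀ ℕ) (σ : Time) (f : A) :
    T.mixed (m + Finsupp.single σ 1) f = T.mixed m (T.der σ f) := by
  classical
  have hc : ∀ τ τ' : Time, Commute (T.der τ : Module.End ℚ A) (T.der τ' : Module.End ℚ A) :=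
    fun τ τ' => LinearMap.ext fun f => T.comm τ τ' f
  have hmem : σ ∈ (m + Finsupp.single σ 1).support := by simp
  have herase : ∀ τ ∈ (m + Finsupp.single σ 1).support.erase σ,
      (m + Finsupp.single σ 1 : Time →₀ ℕ) τ = m τ := fun τ hτ => by
    have := Finset.ne_of_mem_erase hτ
    simp [this.symm]
  have hsupp : (m + Finsupp.single σ 1).support.erase σ = m.support.erase σ := by
    ext τ
    simp only [mem_erase, Finsupp.mem_support_iff, Finsupp.add_apply, Finsupp.single_apply]
    refine and_congr_right fun h => ?_
    rw [if_neg h.symm, add_zero]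
  have hL : T.mixed (m + Finsupp.single σ 1) =
      (m.support.erase σ).noncommProd (fun τ => (T.der τ : Module.End ℚ A) ^ m τ)
        (fun τ _ τ' _ _ => (hc τ τ').pow_pow _ _) * (T.der σ : Module.End ℚ A) ^ (m σ + 1) := by
    refine (noncommProd_erase_mul _ hmem (fun τ => (T.der τ : Module.End ℚ A) ^
      (m + Finsupp.single σ 1 : Time →₀ ℕ) τ)
      (fun τ _ τ' _ _ => (hc τ τ').pow_pow _ _)).symm.trans ?_
    congr 1
    · exact noncommProd_congr hsupp (fun τ hτ => by rw [herase τ (hsupp ▸ hτ)]) _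
    · simp
  have hR : T.mixed m =
      (m.support.erase σ).noncommProd (fun τ => (T.der τ : Module.End ℚ A) ^ m τ)
        (fun τ _ τ' _ _ => (hc τ τ').pow_pow _ _) * (T.der σ : Module.End ℚ A) ^ m σ := by
    by_cases h : σ ∈ m.support
    · exact (noncommProd_erase_mul _ h (fun τ => (T.der τ : Module.End ℚ A) ^ m τ)
        (fun τ _ τ' _ _ => (hc τ τ').pow_pow _ _)).symm
    · rw [Finsupp.notMem_support_iff.1 h, pow_zero, mul_one]
      exact noncommProd_congr (by rw [erase_eq_of_notMem h]) (fun _ _ => rfl) _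
  rw [hL, hR, pow_succ]
  rfl

theorem coeff_taylor (m : Time →₀ ℕ) (f : A) : MvPowerSeries.coeff m (T.taylor f) =
    (m.prod fun _ e => (e.factorial : ℚ)⁻¹) • T.mixed m f := rfl

theorem taylor_zero : T.taylor (0 : A) = 0 := by
  ext m
  rw [coeff_taylor, map_zero, map_zero, smul_zero]

theorem taylor_add (f g : A) : T.taylor (f + g) = T.taylor f + T.taylor g := by
  ext m
  rw [map_add, coeff_taylor, coeff_taylor, coeff_taylor, map_add, smul_add]

theorem taylor_intCast_mul (c : ℤ) (f : A) : T.taylor (c * f) = MvPowerSeries.C (c : A) *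
    T.taylor f := by
  ext m
  rw [MvPowerSeries.coeff_C_mul, coeff_taylor, coeff_taylor, ← zsmul_eq_mul, ← zsmul_eq_mul,
    map_zsmul, smul_comm]

theorem pderiv_taylor (σ : Time) (f : A) :
    MvPowerSeries.pderiv A σ (T.taylor f) = T.taylor (T.der σ f) := by
  ext m
  rw [MvPowerSeries.coeff_pderiv, coeff_taylor, coeff_taylor, mixed_add_single]
  have h := prod_factorial_add_single m σ fun _ => 1
  simp only [one_pow, one_div, one_mul] at h
  rw [← h, mul_comm, mul_smul, Algebra.smul_def, Algebra.smul_def, Algebra.smul_def]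
  simp only [map_add, map_natCast, map_one]
  ring

/-- The contribution of `u_i z^i` and `v_j z^j` to the residue. -/
noncomputable def TimeFlows.residueTerm (u v : ℤ → A) (p : ℤ × ℤ) : MvPowerSeries Time A :=
  MvPowerSeries.C (u p.1) * T.taylor (v p.2) * χ.expCoeff A (-1 - p.1 - p.2)

theorem coeff_residue (u v : ℤ → A) (χ' : Phase) (m : Time →₀ ℕ) :
    MvPowerSeries.coeff m (T.residue ⟨u, χ'⟩ ⟨v, χ⟩) =
      ∑ᶠ p, MvPowerSeries.coeff m (T.residueTerm χ u v p) := rfl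

/-- A fixed monomial in the times sees only finitely many powers of z in the exponential, so the sum
of the two indices takes finitely many values; `u` and `v` being bounded on the same side leaves
finitely many pairs. -/
theorem finite_support_residueTerm {s : Bool} {u v : ℤ → A} (hu : HalfBdd s u)
    (hv : HalfBdd s v) (m : Time →₀ ℕ) :
    (support fun p => MvPowerSeries.coeff m (T.residueTerm χ u v p)).Finite := by
  classical
  obtain ⟨k, hk⟩ := hu
  obtain ⟨l, hl⟩ := hv
  have hfin : ∀ q : ℤ, {p : ℤ × ℤ | u p.1 ≠ 0 ∧ v p.2 ≠ 0 ∧ q = -1 - p.1 - p.2}.Finite := by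
    intro q
    refine ((Set.finite_Icc (min k (l - 1 - q)) (max (-k) (-1 - q - l))).prod
      (Set.finite_Icc (min l (k - 1 - q)) (max (-l) (-1 - q - k)))).subset ?_
    rintro ⟨i, j⟩ ⟨h1, h2, h3⟩
    have h1 := mt (hk i) h1
    have h2 := mt (hl j) h2
    simp only [Set.mem_prod, Set.mem_Icc]
    cases s <;> simp only [if_true, Bool.false_eq_true, if_false] at h1 h2 h3 <;> omega
  refine ((antidiagonal m).finite_toSet.biUnion fun b _ =>
    hfin (b.2.sum fun τ e => (e : ℤ) * χ.pow τ)).subset fun p hp => ?_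
  have h1 : u p.1 ≠ 0 := fun h => hp (by simp [TimeFlows.residueTerm, h])
  have h2 : v p.2 ≠ 0 := fun h => hp (by simp [TimeFlows.residueTerm, h, taylor_zero])
  rw [mem_support, TimeFlows.residueTerm, MvPowerSeries.coeff_mul] at hp
  obtain ⟨b, hb, hne⟩ := exists_ne_zero_of_sum_ne_zero hp
  simp only [Set.mem_iUnion]
  refine ⟨b, hb, h1, h2, ?_⟩
  by_contra h
  exact right_ne_zero_of_mul hne (if_neg h)

/-- The series variables are increments of the primed times, so the coefficients of `u` are
constants and only the second factor is differentiated. The power of z coming from the exponential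
is absorbed by shifting the second index. -/
theorem pderiv_residue {s : Bool} {u v : ℤ → A} (hu : HalfBdd s u) (hv : HalfBdd s v)
    (χ' : Phase) (σ : Time) : MvPowerSeries.pderiv A σ (T.residue ⟨u, χ'⟩ ⟨v, χ⟩) =
      T.residue ⟨u, χ'⟩ ⟨T.flow χ σ v, χ⟩ := by
  ext m
  have hd := hv.derOp T σ
  have hs := (hv.shift (χ.pow σ)).smul (χ.coeff σ : A)
  have hL : ∀ p, MvPowerSeries.coeff (m + Finsupp.single σ 1) (T.residueTerm χ u v p) *
      ((m σ : A) + 1) = MvPowerSeries.coeff m (T.residueTerm χ u (T.derOp σ v) p) +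
        MvPowerSeries.coeff m (T.residueTerm χ u
          ((χ.coeff σ : A) • fun n => v (n - χ.pow σ)) (p.1, p.2 + χ.pow σ)) := by
    intro p
    rw [← MvPowerSeries.coeff_pderiv, ← map_add]
    congr 1
    simp only [TimeFlows.residueTerm, Derivation.leibniz, smul_eq_mul, pderiv_taylor,
      pderiv_expCoeff, MvPowerSeries.pderiv_C, Pi.smul_apply, add_sub_cancel_right,
      taylor_intCast_mul, TimeFlows.derOp]
    rw [show -1 - p.1 - (p.2 + χ.pow σ) = -1 - p.1 - p.2 - χ.pow σ by ring]
    ring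
  have hR : ∀ p, T.residueTerm χ u (T.flow χ σ v) p = T.residueTerm χ u (T.derOp σ v) p +
      T.residueTerm χ u ((χ.coeff σ : A) • fun n => v (n - χ.pow σ)) p := fun p => by
    simp only [TimeFlows.residueTerm, TimeFlows.flow, Pi.add_apply, taylor_add]
    ring
  have hf := finite_support_residueTerm T χ hu hd m
  have hg := finite_support_residueTerm T χ hu hs m
  let e : ℤ × ℤ ≃ ℤ × ℤ := (Equiv.refl ℤ).prodCongr (Equiv.addRight (χ.pow σ))
  rw [MvPowerSeries.coeff_pderiv, coeff_residue, coeff_residue,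
    finsum_mul' (h := finite_support_residueTerm T χ hu hv _)]
  simp only [hL, hR, map_add]
  rw [finsum_add_distrib hf hg]
  refine (finsum_add_distrib hf (hg.preimage (f := e) e.injective.injOn)).trans ?_
  congr 1
  exact finsum_comp_equiv e (f := fun p => MvPowerSeries.coeff m (T.residueTerm χ u _ p))

theorem coeff_zero_residue {s : Bool} {u v : ℤ → A} (hu : HalfBdd s u) (hv : HalfBdd s v)
    (χ' : Phase) : MvPowerSeries.coeff 0 (T.residue ⟨u, χ'⟩ ⟨v, χ⟩) = pair u v := by
  rw [coeff_residue, finsum_curry _ (finite_support_residueTerm T χ hu hv 0), pair]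
  refine finsum_congr fun i => ?_
  have h : ∀ j, MvPowerSeries.coeff 0 (T.residueTerm χ u v (i, j)) =
      u i * v j * if 0 = -1 - i - j then 1 else 0 := fun j => by
    rw [TimeFlows.residueTerm, MvPowerSeries.coeff_zero_eq_constantCoeff, map_mul, map_mul,
      MvPowerSeries.constantCoeff_C, ← MvPowerSeries.coeff_zero_eq_constantCoeff]
    simp only [MvPowerSeries.coeff_apply, TimeFlows.taylor, Phase.expCoeff, Finsupp.prod_zero_index,
      Finsupp.sum_zero_index, mixed_zero, one_smul, map_one]
  simp only [h]
  rw [finsum_eq_single _ (-1 - i)]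
  · simp
  · intro j hj
    rw [if_neg (by omega), mul_zero]

/-- The bilinear equation is equivalent to a family of residue identities. -/
theorem residue_eq_iff {s s' : Bool} {u v u' v' : ℤ → A} {χ χ' χ₀ χ₀' : Phase}
    (hu : HalfBdd s u) (hv : HalfBdd s v) (hu' : HalfBdd s' u') (hv' : HalfBdd s' v') :
    T.residue ⟨u, χ₀⟩ ⟨v, χ⟩ = T.residue ⟨u', χ₀'⟩ ⟨v', χ'⟩ ↔
      ∀ w, pair u (T.flows χ w v) = pair u' (T.flows χ' w v') := by
  constructor
  · intro h w
    rw [← coeff_zero_residue T χ hu (hv.flows T χ w) χ₀,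
      ← coeff_zero_residue T χ' hu' (hv'.flows T χ' w) χ₀']
    congr 1
    induction w with
    | nil => exact h
    | cons σ w ih =>
      have h1 := pderiv_residue T χ hu (hv.flows T χ w) χ₀ σ
      have h2 := pderiv_residue T χ' hu' (hv'.flows T χ' w) χ₀' σ
      rw [ih, h2] at h1
      exact h1.symm
  · intro h
    ext m
    -- A coefficient of positive degree is recovered from one of a derivative, of smaller degree,
    -- because m_σ + 1 is invertible over ℚ.
    induction hn : m.degree generalizing m v v' with
    | zero =>
      obtain rfl : m = 0 := (Finsupp.degree_eq_zero_iff m).1 hn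
      rw [coeff_zero_residue T χ hu hv, coeff_zero_residue T χ' hu' hv']
      exact h []
    | succ n ih =>
      obtain ⟨σ, hσ⟩ : ∃ σ, m σ ≠ 0 := by
        by_contra! h0
        rw [show m = 0 from Finsupp.ext h0] at hn
        simp at hn
      obtain ⟨m', rfl⟩ : ∃ m', m = m' + Finsupp.single σ 1 :=
        ⟨m - Finsupp.single σ 1, (tsub_add_cancel_of_le (by simp; omega)).symm⟩
      -- The innermost derivative is the last letter of the word, so differentiating `v` and `v'`
      -- appends `σ`.
      have h1 := ih (hv.flow T χ σ) (hv'.flow T χ' σ) (fun w => by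
        simpa [TimeFlows.flows] using h (w ++ [σ])) m' (by simpa using hn)
      rw [← pderiv_residue T χ hu hv, ← pderiv_residue T χ' hu' hv', MvPowerSeries.coeff_pderiv,
        MvPowerSeries.coeff_pderiv] at h1
      refine IsUnit.mul_right_cancel ?_ h1
      have h2 : IsUnit ((m' σ : ℚ) + 1) := IsUnit.mk0 _ (by positivity)
      simpa using h2.map (algebraMap ℚ A)

end Residues

/-! ### Positive and negative parts, powers of conjugates. -/

section Parts

variable {A : Type*} [CommRing A]

theorem NonNeg.halfBdd {F : ℤ → A} (hF : NonNeg F) : HalfBdd true F :=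
  ⟨0, fun i hi => hF i (by simpa using hi)⟩

theorem pos_add_neg (F : Op A) : F.pos + F.neg = F := funext fun n => by
  simp only [Op.pos, Op.neg, Pi.add_apply]
  split_ifs <;> first | omega | simp

theorem pos_nonNeg (F : Op A) : NonNeg F.pos := fun n hn => if_neg (by omega)

theorem NonNeg.add {F G : Op A} (hF : NonNeg F) (hG : NonNeg G) : NonNeg (F + G) :=
  fun n hn => by rw [Pi.add_apply, hF n hn, hG n hn, add_zero]

theorem NonNeg.sub {F G : Op A} (hF : NonNeg F) (hG : NonNeg G) : NonNeg (F - G) :=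
  fun n hn => by rw [Pi.sub_apply, hF n hn, hG n hn, sub_zero]

end Parts

section Operators

variable {A : Type*} [CommRing A] [Algebra ℚ A] [GradedDifferentialAlgebra A]

theorem HalfBdd.inAlg {s : Bool} {F : Op A} (hF : HalfBdd s F) : InAlg s F :=
  let ⟨k, hk⟩ := hF
  ⟨k, fun i j h => by
    rw [hk i (by cases s <;> simp only [wt, if_true, Bool.false_eq_true, if_false] at h ⊢ <;> omega),
      map_zero]⟩

theorem InAlg.halfBdd {F : Op A} (hF : InAlg false F) : HalfBdd false F :=
  let ⟨k, hk⟩ := mem_DMinus_iff.2 hF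
  ⟨-k, fun i hi => hk i (by simp only [Bool.false_eq_true, if_false] at hi; omega)⟩

theorem fil_false_one_iff {F : Op A} : Fil false 1 F ↔ ∀ n, 0 ≤ n → F n = 0 := by
  simp only [Fil, wt, Bool.false_eq_true, if_false]
  exact ⟨fun h n hn => eq_zero_of_comp fun j => h n j (by omega),
    fun h i j hij => by rw [h i (by omega), map_zero]⟩

theorem InAlg.of_support {s : Bool} {F G : Op A} (hF : InAlg s F)
    (h : ∀ i, G i = F i ∨ G i = 0) : InAlg s G :=
  let ⟨k, hk⟩ := hF
  ⟨k, fun i j hij => by rcases h i with h | h <;> rw [h]; exacts [hk i j hij, map_zero _]⟩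

theorem InAlg.pos {s : Bool} {F : Op A} (hF : InAlg s F) : InAlg s F.pos :=
  hF.of_support fun i => by rw [Op.pos]; split_ifs <;> simp

theorem InAlg.negPart {s : Bool} {F : Op A} (hF : InAlg s F) : InAlg s F.neg :=
  hF.of_support fun i => by rw [Op.neg]; split_ifs <;> simp

theorem fil_neg (F : Op A) : Fil false 1 F.neg :=
  fil_false_one_iff.2 fun n hn => if_neg (by omega)

theorem mul_cancel_right {s : Bool} {F G X : Op A} (hF : InAlg s F) (hG : InAlg s G)
    (hX : InAlg s X) (h : Op.mul F G = Op.monomial 1 0) : Op.mul (Op.mul X F) G = X := by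
  rw [op_mul_assoc hX hF hG, h, mul_one_op]

theorem inAlg_pow {s : Bool} {F : Op A} (hF : InAlg s F) (n : ℕ) : InAlg s (F.pow n) := by
  induction n with
  | zero => exact inAlg_monomial s 1 0
  | succ n ih => exact ih.mul hF

theorem conj_pow {s : Bool} {F G : Op A} (hF : InAlg s F) (hG : InAlg s G)
    (hFG : Op.mul F G = Op.monomial 1 0) (hGF : Op.mul G F = Op.monomial 1 0) (p : ℤ) (n : ℕ) :
    Op.pow (Op.mul (Op.mul F (Op.monomial 1 p)) G) n =
      Op.mul (Op.mul F (Op.monomial 1 (p * n))) G := by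
  have hm : ∀ q : ℤ, InAlg s (Op.monomial (1 : A) q) := inAlg_monomial s 1
  induction n with
  | zero => rw [Op.pow, Nat.cast_zero, mul_zero, mul_one_op, hFG]
  | succ n ih =>
    rw [Op.pow, ih, ← op_mul_assoc ((hF.mul (hm _)).mul hG) (hF.mul (hm _)) hG,
      ← op_mul_assoc ((hF.mul (hm _)).mul hG) hF (hm _),
      mul_cancel_right hG hF (hF.mul (hm _)) hGF, op_mul_assoc hF (hm _) (hm _),
      monomial_mul_monomial_one]
    congr 3
    push_cast
    ring

end Operators

/-! ### Time derivatives as operator identities. -/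

section Flows

variable {A : Type*} [CommRing A] [Algebra ℚ A] [GradedDifferentialAlgebra A] (T : TimeFlows A)

theorem flow_eq (χ : Phase) (σ : Time) (F : Op A) : T.flow χ σ F =
    T.derOp σ F + (χ.coeff σ : A) • Op.mul F (Op.monomial 1 (χ.pow σ)) := by
  rw [TimeFlows.flow]
  congr 2
  exact funext fun n => (mul_monomial_one F _ n).symm

/-- The exponential stands to the right of both operators, so the phase acts only through `G`. -/
theorem flow_mul (χ : Phase) (σ : Time) {s : Bool} {F G : Op A} (hF : InAlg s F)
    (hG : InAlg s G) :
    T.flow χ σ (Op.mul F G) = Op.mul (T.derOp σ F) G + Op.mul F (T.flow χ σ G) := by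
  have hm : InAlg s (Op.monomial (1 : A) (χ.pow σ)) := inAlg_monomial s 1 _
  have hc : InAlg s ((χ.coeff σ : A) • Op.mul G (Op.monomial 1 (χ.pow σ))) := by
    rw [← monomial_zero_mul]
    exact (inAlg_monomial s _ 0).mul (hG.mul hm)
  rw [flow_eq, flow_eq, op_mul_add hF (hG.derOp T σ) hc, op_mul_intCast_smul hF (hG.mul hm),
    derOp_mul T σ hF hG, op_mul_assoc hF hG hm, add_assoc]

theorem flow_xi_inl (k : ℕ+) (F : Op A) : T.flow Phase.xi (Sum.inl k) F =
    T.derOp (Sum.inl k) F + Op.mul F (Op.monomial 1 k) := by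
  simp [flow_eq, Phase.xi]

theorem flow_xi_inr (k : ℕ+) (F : Op A) : T.flow Phase.xi (Sum.inr k) F =
    T.derOp (Sum.inr k) F := by
  simp [flow_eq, Phase.xi]

theorem flow_xiHat_inl (k : ℕ+) (F : Op A) : T.flow Phase.xiHat (Sum.inl k) F =
    T.derOp (Sum.inl k) F + if k = 1 then Op.mul F (Op.monomial 1 1) else 0 := by
  by_cases hk : k = 1
  · subst hk
    simp [flow_eq, Phase.xiHat]
  · simp [flow_eq, Phase.xiHat, hk]

theorem flow_xiHat_inr (k : ℕ+) (F : Op A) : T.flow Phase.xiHat (Sum.inr k) F =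
    T.derOp (Sum.inr k) F - Op.mul F (Op.monomial 1 (-k)) := by
  simp [flow_eq, Phase.xiHat, sub_eq_add_neg]

/-- Since t_1 = x, the commutator of ∂ with an operator is its coefficientwise t_1-derivative. -/
theorem d_mul_eq (F : Op A) : Op.mul (Op.monomial 1 1) F =
    T.derOp (Sum.inl 1) F + Op.mul F (Op.monomial 1 1) := funext fun n => by
  rw [d_mul_op, Pi.add_apply, mul_monomial_one, TimeFlows.derOp, T.der_x]

theorem flow_xi_x (F : Op A) :
    T.flow Phase.xi (Sum.inl 1) F = Op.mul (Op.monomial 1 1) F := by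
  rw [flow_xi_inl, d_mul_eq T]
  rfl

theorem flow_xiHat_x (F : Op A) :
    T.flow Phase.xiHat (Sum.inl 1) F = Op.mul (Op.monomial 1 1) F := by
  rw [flow_xiHat_inl, d_mul_eq T, if_pos rfl]

theorem flow_neg_xi_x (v : ℤ → A) (n : ℤ) : T.flow (Phase.xi.smul (-1)) (Sum.inl 1) v n =
    T.der (Sum.inl 1) (v n) - v (n - 1) := by
  simp [flow_apply, Phase.xi, Phase.smul, sub_eq_add_neg]

theorem flow_neg_xiHat_x (v : ℤ → A) (n : ℤ) :
    T.flow (Phase.xiHat.smul (-1)) (Sum.inl 1) v n = T.der (Sum.inl 1) (v n) - v (n - 1) := by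
  simp [flow_apply, Phase.xiHat, Phase.smul, sub_eq_add_neg]

theorem flow_neg_xiHat_inr (k : ℕ+) (v : ℤ → A) (n : ℤ) :
    T.flow (Phase.xiHat.smul (-1)) (Sum.inr k) v n = T.der (Sum.inr k) (v n) + v (n + k) := by
  simp [flow_apply, Phase.xiHat, Phase.smul]

end Flows

/-! ### The hierarchy as a compatibility condition. -/

namespace Dressing

variable {A : Type*} [CommRing A] [Algebra ℚ A] [GradedDifferentialAlgebra A] (S : Dressing A)
variable (T : TimeFlows A)

theorem inAlg_P : InAlg false S.P :=
  (S.inAlg_phi.mul (inAlg_monomial _ _ _)).mul S.inAlg_phiInv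

theorem inAlg_PHat : InAlg true S.PHat :=
  (S.inAlg_phiHat.mul (inAlg_monomial _ _ _)).mul S.inAlg_phiHatInv

theorem P_pow (k : ℕ) : S.P.pow k = Op.mul (Op.mul S.Phi (Op.monomial 1 k)) S.PhiInv := by
  rw [P, conj_pow S.inAlg_phi S.inAlg_phiInv S.phi_mul_phiInv S.phiInv_mul_phi, one_mul]

theorem PHat_pow (k : ℕ) :
    S.PHat.pow k = Op.mul (Op.mul S.PhiHat (Op.monomial 1 (-k))) S.PhiHatInv := by
  rw [PHat, conj_pow S.inAlg_phiHat S.inAlg_phiHatInv S.phiHat_mul_phiHatInv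
    S.phiHatInv_mul_phiHat, neg_one_mul]

theorem P_pow_mul_phi (k : ℕ) : Op.mul (S.P.pow k) S.Phi = Op.mul S.Phi (Op.monomial 1 k) := by
  rw [P_pow, mul_cancel_right S.inAlg_phiInv S.inAlg_phi
    (S.inAlg_phi.mul (inAlg_monomial _ _ _)) S.phiInv_mul_phi]

theorem PHat_pow_mul_phiHat (k : ℕ) :
    Op.mul (S.PHat.pow k) S.PhiHat = Op.mul S.PhiHat (Op.monomial 1 (-k)) := by
  rw [PHat_pow, mul_cancel_right S.inAlg_phiHatInv S.inAlg_phiHat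
    (S.inAlg_phiHat.mul (inAlg_monomial _ _ _)) S.phiHatInv_mul_phiHat]

theorem inv_PHat : Op.inv (DPlus A) S.PHat =
    Op.mul (Op.mul S.PhiHat (Op.monomial 1 1)) S.PhiHatInv := by
  have hm : ∀ q : ℤ, InAlg true (Op.monomial (1 : A) q) := inAlg_monomial true 1
  have h : ∀ p q : ℤ, p + q = 0 →
      Op.mul (Op.mul (Op.mul S.PhiHat (Op.monomial 1 p)) S.PhiHatInv)
        (Op.mul (Op.mul S.PhiHat (Op.monomial 1 q)) S.PhiHatInv) = Op.monomial 1 0 := by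
    intro p q hpq
    rw [← op_mul_assoc ((S.inAlg_phiHat.mul (hm _)).mul S.inAlg_phiHatInv)
      (S.inAlg_phiHat.mul (hm _)) S.inAlg_phiHatInv,
      ← op_mul_assoc ((S.inAlg_phiHat.mul (hm _)).mul S.inAlg_phiHatInv) S.inAlg_phiHat (hm _),
      mul_cancel_right S.inAlg_phiHatInv S.inAlg_phiHat (S.inAlg_phiHat.mul (hm _))
        S.phiHatInv_mul_phiHat, op_mul_assoc S.inAlg_phiHat (hm _) (hm _),
      monomial_mul_monomial_one, hpq, mul_one_op, S.phiHat_mul_phiHatInv]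
  exact op_inv_eq (fun _ => mem_DPlus_iff) S.inAlg_PHat
    ((S.inAlg_phiHat.mul (hm _)).mul S.inAlg_phiHatInv) (h _ _ (by norm_num)) (h _ _ (by norm_num))

theorem inAlg_inv_PHat : InAlg true (Op.inv (DPlus A) S.PHat) := by
  rw [inv_PHat]
  exact (S.inAlg_phiHat.mul (inAlg_monomial _ _ _)).mul S.inAlg_phiHatInv

theorem inv_PHat_mul_phiHat : Op.mul (Op.inv (DPlus A) S.PHat) S.PhiHat =
    Op.mul S.PhiHat (Op.monomial 1 1) := by
  rw [inv_PHat, mul_cancel_right S.inAlg_phiHatInv S.inAlg_phiHat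
    (S.inAlg_phiHat.mul (inAlg_monomial _ _ _)) S.phiHatInv_mul_phiHat]

/-- All time derivatives of the two wave functions are given by the same operators. -/
def IsCompatible : Prop :=
  ∀ σ : Time, ∃ R : Op A, InAlg false R ∧ InAlg true R ∧
    T.flow Phase.xi σ S.Phi = Op.mul R S.Phi ∧
    T.flow Phase.xiHat σ S.PhiHat = Op.mul R S.PhiHat

theorem fil_phiInv : Fil false 0 S.PhiInv := fun i j h => by
  rw [S.phiInv_of_pos (by simp only [wt, Bool.false_eq_true, if_false] at h; omega), map_zero]

theorem fil_phi : Fil false 0 S.Phi := fun i j h => by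
  rw [S.phi_of_pos (by simp only [wt, Bool.false_eq_true, if_false] at h; omega), map_zero]

variable {S T}

/-- Since P^k Φ = Φ ∂^k, the t_k-equation for Φ says that (P^k)_+ generates the derivative of ψ;
likewise -(P̂^k)_- does so for ψ̂ and t̂_k. The first operator has finite order and the second only
negative orders, so each lies in both algebras. -/
theorem IsSolution.isCompatible (h : S.IsSolution T) : S.IsCompatible T := by
  rintro (k | k)
  · obtain ⟨h1, h2, -, -⟩ := h k
    have hP := inAlg_pow S.inAlg_P k
    refine ⟨Op.pos (S.P.pow k), hP.pos, inAlg_of_nonNeg (pos_nonNeg _), ?_, ?_⟩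
    · rw [flow_xi_inl, h1, show Op.monomial (1 : A) (k : ℤ) = Op.monomial 1 ((k : ℕ) : ℤ) from rfl,
        ← P_pow_mul_phi]
      conv_lhs => rw [← pos_add_neg (S.P.pow k)]
      rw [op_add_mul hP.pos hP.negPart S.inAlg_phi, pos_add_neg]
      abel
    · rw [flow_xiHat_inl, h2]
      split_ifs with hk
      · rw [op_sub_mul (inAlg_of_nonNeg (pos_nonNeg _)) S.inAlg_inv_PHat S.inAlg_phiHat,
          inv_PHat_mul_phiHat, sub_add_cancel]
      · rw [sub_zero, add_zero]
  · obtain ⟨-, -, h3, h4⟩ := h k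
    have hP := inAlg_pow S.inAlg_PHat k
    refine ⟨-Op.neg (S.PHat.pow k), InAlg.neg ⟨_, fil_neg _⟩, hP.negPart.neg, ?_, ?_⟩
    · rw [flow_xi_inr, h3, op_neg_mul]
    · rw [flow_xiHat_inr, h4,
        show Op.monomial (1 : A) (-(k : ℤ)) = Op.monomial 1 (-((k : ℕ) : ℤ)) from rfl,
        ← PHat_pow_mul_phiHat]
      conv_lhs => arg 2; rw [← pos_add_neg (S.PHat.pow k)]
      rw [op_add_mul hP.pos hP.negPart S.inAlg_phiHat, op_neg_mul]
      abel

theorem fil_derOp_phi (σ : Time) : Fil false 1 (T.derOp σ S.Phi) :=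
  fil_false_one_iff.2 fun n hn => by
    rw [TimeFlows.derOp]
    rcases hn.eq_or_lt with rfl | hn
    · rw [phi_zero, Derivation.map_one_eq_zero]
    · rw [S.phi_of_pos hn, map_zero]

theorem derOp_phi_mul_phiInv (σ : Time) {n : ℤ} (hn : 0 ≤ n) :
    Op.mul (T.derOp σ S.Phi) S.PhiInv n = 0 := by
  have h := (fil_derOp_phi (T := T) (S := S) σ).mul S.fil_phiInv
  rw [add_zero] at h
  exact fil_false_one_iff.1 h n hn

theorem nonNeg_derOp_phiHat (σ : Time) : NonNeg (T.derOp σ S.PhiHat) := fun n hn => by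
  rw [TimeFlows.derOp, S.phiHat_nonNeg n hn, map_zero]

/-- Solving both equations for `R` determines it. For t_k, it is P^k plus negative orders by the
first and has no negative orders by the second; for t̂_k, it has only negative orders by the first
and is -P̂^k plus nonnegative orders by the second. -/
theorem IsCompatible.isSolution (h : S.IsCompatible T) : S.IsSolution T := by
  intro k
  have hm : ∀ (s : Bool) (q : ℤ), InAlg s (Op.monomial (1 : A) q) := fun s => inAlg_monomial s 1
  have hcancel : ∀ {R : Op A}, InAlg false R → Op.mul (Op.mul R S.Phi) S.PhiInv = R := fun hR =>
    mul_cancel_right S.inAlg_phi S.inAlg_phiInv hR S.phi_mul_phiInv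
  have hcancel' : ∀ {R : Op A}, InAlg true R →
      Op.mul (Op.mul R S.PhiHat) S.PhiHatInv = R := fun hR =>
    mul_cancel_right S.inAlg_phiHat S.inAlg_phiHatInv hR S.phiHat_mul_phiHatInv
  refine and_assoc.1 ⟨?_, ?_⟩
  · obtain ⟨R, hRm, hRp, h1, h2⟩ := h (Sum.inl k)
    have hP := inAlg_pow S.inAlg_P k
    have hR0 : NonNeg R := by
      rw [← hcancel' hRp, ← h2, flow_xiHat_inl]
      refine ((nonNeg_derOp_phiHat _).add ?_).mul S.phiHatInv_nonNeg
      split_ifs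
      · exact S.phiHat_nonNeg.mul fun n hn => if_neg (by omega)
      · exact fun _ _ => rfl
    have hR : R = Op.mul (T.derOp (Sum.inl k) S.Phi) S.PhiInv + S.P.pow k := by
      rw [← hcancel hRm, ← h1, flow_xi_inl, op_add_mul (S.inAlg_phi.derOp T _)
        (S.inAlg_phi.mul (hm _ _)) S.inAlg_phiInv, P_pow]
    have hpos : Op.pos (S.P.pow k) = R := funext fun n => by
      rcases lt_or_ge n 0 with hn | hn
      · rw [hR0 n hn, pos_nonNeg _ n hn]
      · rw [hR, Pi.add_apply, derOp_phi_mul_phiInv _ hn, zero_add, Op.pos, if_pos hn]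
    constructor
    · have h3 : Op.mul (S.P.pow k) S.Phi =
          Op.mul (Op.pos (S.P.pow k)) S.Phi + Op.mul (Op.neg (S.P.pow k)) S.Phi := by
        rw [← op_add_mul hP.pos hP.negPart S.inAlg_phi, pos_add_neg]
      rw [P_pow_mul_phi, hpos, ← h1, flow_xi_inl] at h3
      rw [eq_neg_iff_add_eq_zero]
      refine add_left_cancel (a := Op.mul S.Phi (Op.monomial 1 ((k : ℕ) : ℤ))) ?_
      rw [add_zero, ← add_assoc, add_comm (Op.mul S.Phi _)]
      exact h3.symm
    · rw [flow_xiHat_inl] at h2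
      rw [hpos]
      split_ifs at h2 ⊢
      · rw [op_sub_mul hRp S.inAlg_inv_PHat S.inAlg_phiHat, inv_PHat_mul_phiHat, ← h2,
          add_sub_cancel_right]
      · rw [sub_zero, ← h2, add_zero]
  · obtain ⟨R, hRm, hRp, h1, h2⟩ := h (Sum.inr k)
    have hR0 : ∀ n, 0 ≤ n → R n = 0 := fun n hn => by
      rw [← hcancel hRm, ← h1, flow_xi_inr, derOp_phi_mul_phiInv _ hn]
    have hR : S.PHat.pow k = Op.mul (T.derOp (Sum.inr k) S.PhiHat) S.PhiHatInv - R := by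
      conv_rhs => rw [← hcancel' hRp, ← h2, flow_xiHat_inr, op_sub_mul (S.inAlg_phiHat.derOp T _)
        (S.inAlg_phiHat.mul (hm _ _)) S.inAlg_phiHatInv, sub_sub_cancel]
      exact S.PHat_pow k
    have hneg : Op.neg (S.PHat.pow k) = -R := funext fun n => by
      rw [Op.neg, Pi.neg_apply]
      split_ifs with hn
      · rw [hR, Pi.sub_apply, ((nonNeg_derOp_phiHat _).mul S.phiHatInv_nonNeg) n hn, zero_sub]
      · rw [hR0 n (by omega), neg_zero]
    constructor
    · rw [hneg, op_neg_mul, neg_neg, ← h1, flow_xi_inr]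
    · have hpos : Op.pos (S.PHat.pow k) = S.PHat.pow k + R := by
        conv_rhs => rw [← pos_add_neg (S.PHat.pow k), hneg, neg_add_cancel_right]
      rw [hpos, op_add_mul (inAlg_pow S.inAlg_PHat k) hRp S.inAlg_phiHat, PHat_pow_mul_phiHat,
        ← h2, flow_xiHat_inr]
      exact (add_sub_cancel _ _).symm

theorem isSolution_iff : S.IsSolution T ↔ S.IsCompatible T :=
  ⟨IsSolution.isCompatible, IsCompatible.isSolution⟩

end Dressing

/-! ### Normal forms of the series. -/

section Series

variable {A : Type*} [CommRing A]

/-- `u` has no positive powers and constant term `1`. -/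
def IsMonic (u : ℤ → A) : Prop := u 0 = 1 ∧ ∀ n, 0 < n → u n = 0

theorem IsMonic.halfBdd {u : ℤ → A} (hu : IsMonic u) : HalfBdd false u :=
  ⟨0, fun i hi => hu.2 i (by simpa using hi)⟩

theorem isMonic_nonposSeries (a : ℕ+ → A) : IsMonic (nonposSeries 1 a) := by
  refine ⟨rfl, fun n hn => ?_⟩
  obtain ⟨k, rfl⟩ : ∃ k : ℕ, n = Int.ofNat (k + 1) := ⟨n.toNat - 1, by simp; omega⟩
  rfl

theorem IsMonic.eq_nonposSeries {u : ℤ → A} (hu : IsMonic u) :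
    u = nonposSeries 1 fun k => u (-k) := funext fun n => by
  match n with
  | Int.ofNat 0 => exact hu.1
  | Int.ofNat (n + 1) => exact hu.2 _ (Int.natCast_pos.2 n.succ_pos)
  | Int.negSucc n => rfl

theorem nonNeg_nonnegSeries (e c : A) (b : ℕ+ → A) : NonNeg fun n => e * nonnegSeries c b n :=
  fun n hn => by
    obtain ⟨k, rfl⟩ : ∃ k : ℕ, n = Int.negSucc k := ⟨(-n).toNat - 1, by omega⟩
    exact mul_zero _

theorem NonNeg.eq_nonnegSeries {u : ℤ → A} (hu : NonNeg u) (e : Aˣ) :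
    u = fun n => ((e⁻¹ : Aˣ) : A) * nonnegSeries (e * u 0) (fun k => e * u k) n :=
  funext fun n => by
    match n with
    | Int.ofNat 0 => exact (e.inv_mul_cancel_left _).symm
    | Int.ofNat (n + 1) => exact (e.inv_mul_cancel_left _).symm
    | Int.negSucc n => exact (hu _ (Int.negSucc_lt_zero n)).trans (mul_zero _).symm

theorem pair_eq_single {u v : ℤ → A} (i j : ℤ) (hij : i + j = -1)
    (h : ∀ k, k ≠ i → u k = 0 ∨ v (-1 - k) = 0) : pair u v = u i * v j := by
  rw [pair, finsum_eq_single _ i, show -1 - i = j by omega]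
  intro k hk
  rcases h k hk with h | h <;> rw [h] <;> simp

theorem pair_nonNeg {u v : ℤ → A} (hu : NonNeg u) (hv : NonNeg v) : pair u v = 0 :=
  finsum_eq_zero_of_forall_eq_zero fun i => by
    rcases lt_or_ge i 0 with hi | hi
    · rw [hu i hi, zero_mul]
    · rw [hv _ (by omega), mul_zero]

end Series

/-! ### Shape of the adjoint wave functions; the bilinear equation for solutions. -/

namespace Dressing

variable {A : Type*} [CommRing A] (S : Dressing A)

theorem psi_eq : S.psi = ⟨S.Phi, Phase.xi.smul 1⟩ := by
  simp [psi, Op.applyExp]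

theorem psiHat_eq : S.psiHat = ⟨S.PhiHat, Phase.xiHat.smul 1⟩ := by
  simp [psiHat, Op.applyExp]

variable [Algebra ℚ A] [GradedDifferentialAlgebra A]
variable (T : TimeFlows A)

theorem isMonic_psiDag : IsMonic S.psiDag.coeff := by
  constructor
  · change (((-1 : ℤˣ) ^ (0 : ℤ) : ℤˣ) : ℤ) • S.PhiInv.adjoint 0 = 1
    rw [Op.adjoint, gsum_eq_single 0]
    · simp [S.phiInv_zero]
    · intro r hr
      rw [S.phiInv_of_pos (by omega), d_iterate_zero, smul_zero, smul_zero]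
  · intro n hn
    change (((-1 : ℤˣ) ^ n : ℤˣ) : ℤ) • S.PhiInv.adjoint n = 0
    rw [Op.adjoint, gsum_congr fun r => by
      rw [S.phiInv_of_pos (by omega), d_iterate_zero, smul_zero, smul_zero], gsum_zero, smul_zero]

theorem nonNeg_psiHatDag : NonNeg S.psiHatDag.coeff := fun n hn => by
  change (((-1 : ℤˣ) ^ n : ℤˣ) : ℤ) • S.PhiHatInv.adjoint n = 0
  have h : ∀ r : ℕ, (((-1 : ℤˣ) ^ (n + r) : ℤˣ) : ℤ) • (Ring.choose (n + r) r : ℤ) •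
      (⇑(d (A := A)))^[r] (S.PhiHatInv (n + r)) = 0 := fun r => by
    rcases lt_or_ge (n + r) 0 with h | h
    · rw [S.phiHatInv_nonNeg _ h, d_iterate_zero, smul_zero, smul_zero]
    · rw [choose_eq_zero h (by omega), zero_smul, smul_zero]
  rw [Op.adjoint, gsum_congr h, gsum_zero, smul_zero]

theorem comp_zero_d_iterate {r : ℕ} (hr : r ≠ 0) (f : A) :
    comp 0 ((⇑(d (A := A)))^[r] f) = 0 :=
  ((degGE_of_nonpos le_rfl f).d_iterate r) 0 (by omega)

theorem comp_zero_mul (f g : A) : comp 0 (f * g) = comp 0 f * comp 0 g := by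
  rw [comp_mul]
  simp

/-- Derivatives have no component of degree 0, so in degree 0 adjoint and product become
commutative, and the constant coefficient of Φ̂⁻¹ is inverse to e^f. The quantity considered is ρ.
-/
theorem degGE_psiHatDag_zero : DegGE 1 ((S.expf : A) * S.psiHatDag.coeff 0 - 1) := by
  have h1 : comp 0 (S.psiHatDag.coeff 0) = comp 0 (S.PhiHatInv 0) := by
    change comp 0 ((((-1 : ℤˣ) ^ (0 : ℤ) : ℤˣ) : ℤ) • S.PhiHatInv.adjoint 0) = _
    rw [map_zsmul, Op.adjoint, comp_gsum, finsum_eq_single _ 0]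
    · simp
    · intro r hr
      rw [map_zsmul, map_zsmul, comp_zero_d_iterate hr, smul_zero, smul_zero]
  have h2 : comp 0 (S.expf * S.PhiHatInv 0) = comp 0 1 := by
    have h := congrArg (comp 0) (congrFun S.phiHat_mul_phiHatInv 0)
    rw [Op.mul, comp_gsum, finsum_eq_single _ (0, 0)] at h
    · simpa [Op.monomial, S.phiHat_zero] using h
    · rintro ⟨i, r⟩ hir
      rw [map_zsmul, comp_zero_mul]
      rcases eq_or_ne r 0 with rfl | hr
      · rcases lt_trichotomy i 0 with hi | rfl | hi
        · rw [S.phiHat_nonNeg i hi, map_zero, zero_mul, smul_zero]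
        · exact absurd rfl hir
        · rw [S.phiHatInv_nonNeg _ (by push_cast; omega), d_iterate_zero, map_zero, mul_zero,
            smul_zero]
      · rw [comp_zero_d_iterate hr, mul_zero, smul_zero]
  intro j hj
  obtain rfl : j = 0 := by omega
  rw [map_sub, comp_zero_mul, h1, ← comp_zero_mul, h2, sub_self]

variable {S T}

/-- The residue identities satisfied by the wave functions of a solution, for all wave functions
obtained from them by the same operator. -/
theorem IsCompatible.pair_eq (h : S.IsCompatible T) (w : List Time) {Y : Op A}
    (hY : InAlg false Y) (hY' : InAlg true Y) (hYm : HalfBdd true (Op.mul Y S.PhiHat)) :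
    pair (Op.mul Y S.Phi) (T.flows (Phase.xi.smul (-1)) w S.psiDag.coeff) =
      pair (Op.mul Y S.PhiHat) (T.flows (Phase.xiHat.smul (-1)) w S.psiHatDag.coeff) := by
  have hv := S.isMonic_psiDag.halfBdd
  have hv' := S.nonNeg_psiHatDag.halfBdd
  induction w generalizing Y with
  | nil =>
    -- Both pairings are the coefficient of ∂⁻¹ in `Y`.
    refine (mul_apply_neg_one Phase.xi (hY.mul S.inAlg_phi) S.inAlg_phiInv
      (hY.mul S.inAlg_phi).halfBdd hv).symm.trans (Eq.trans ?_ (mul_apply_neg_one Phase.xiHat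
        (hY'.mul S.inAlg_phiHat) S.inAlg_phiHatInv hYm hv'))
    rw [mul_cancel_right S.inAlg_phi S.inAlg_phiInv hY S.phi_mul_phiInv,
      mul_cancel_right S.inAlg_phiHat S.inAlg_phiHatInv hY' S.phiHat_mul_phiHatInv]
  | cons σ w ih =>
    obtain ⟨R, hR, hR', h1, h2⟩ := h σ
    -- Moving the derivative onto the first factor replaces `Y` by ∂_σ Y + YR in both components;
    -- this is why the induction runs over general `Y`.
    have h3 : T.flow Phase.xi σ (Op.mul Y S.Phi) =
        Op.mul (T.derOp σ Y + Op.mul Y R) S.Phi := by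
      rw [flow_mul T _ σ hY S.inAlg_phi, h1, ← op_mul_assoc hY hR S.inAlg_phi,
        op_add_mul (hY.derOp T σ) (hY.mul hR) S.inAlg_phi]
    have h4 : T.flow Phase.xiHat σ (Op.mul Y S.PhiHat) =
        Op.mul (T.derOp σ Y + Op.mul Y R) S.PhiHat := by
      rw [flow_mul T _ σ hY' S.inAlg_phiHat, h2, ← op_mul_assoc hY' hR' S.inAlg_phiHat,
        op_add_mul (hY'.derOp T σ) (hY'.mul hR') S.inAlg_phiHat]
    have h5 := der_pair_flow T Phase.xi (hY.mul S.inAlg_phi).halfBdd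
      (hv.flows T (Phase.xi.smul (-1)) w) σ
    have h6 := der_pair_flow T Phase.xiHat hYm (hv'.flows T (Phase.xiHat.smul (-1)) w) σ
    rw [ih hY hY' hYm, h6, h3, h4, ih ((hY.derOp T σ).add (hY.mul hR))
      ((hY'.derOp T σ).add (hY'.mul hR')) (h4 ▸ hYm.flow T _ σ)] at h5
    exact (add_left_cancel h5).symm

theorem IsCompatible.bilinear (h : S.IsCompatible T) :
    T.Bilinear S.psi S.psiDag S.psiHat S.psiHatDag := by
  have h0 := fun s => inAlg_monomial s (1 : A) 0
  rw [TimeFlows.Bilinear, psi_eq, psiHat_eq]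
  refine (residue_eq_iff T S.inAlg_phi.halfBdd S.isMonic_psiDag.halfBdd
    S.phiHat_nonNeg.halfBdd S.nonNeg_psiHatDag.halfBdd).2 fun w => ?_
  have h1 := h.pair_eq w (h0 false) (h0 true)
    (by rw [one_mul_op]; exact S.phiHat_nonNeg.halfBdd)
  rw [one_mul_op, one_mul_op] at h1
  exact h1

end Dressing

/-! ### Closure properties of orthogonal pairs. -/

section OrthogonalClosure

variable {A : Type*} [CommRing A] [Algebra ℚ A] [GradedDifferentialAlgebra A]

/-- The pairs of wave functions orthogonal to all derivatives of the pair `(v, vh)`. -/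
structure Orthogonal (T : TimeFlows A) (v vh F Fh : ℤ → A) : Prop where
  bdd : HalfBdd false F
  bddHat : HalfBdd true Fh
  pair_eq : ∀ w, pair F (T.flows (Phase.xi.smul (-1)) w v) =
    pair Fh (T.flows (Phase.xiHat.smul (-1)) w vh)

variable {T : TimeFlows A} {v vh : ℤ → A} (hv : HalfBdd false v) (hvh : HalfBdd true vh)

include hv hvh

theorem Orthogonal.add {F Fh G Gh : ℤ → A} (hF : Orthogonal T v vh F Fh)
    (hG : Orthogonal T v vh G Gh) : Orthogonal T v vh (F + G) (Fh + Gh) where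
  bdd := hF.bdd.add hG.bdd
  bddHat := hF.bddHat.add hG.bddHat
  pair_eq w := by
    rw [pair_add_left hF.bdd hG.bdd (hv.flows T _ w),
      pair_add_left hF.bddHat hG.bddHat (hvh.flows T _ w), hF.pair_eq, hG.pair_eq]

theorem Orthogonal.smul {F Fh : ℤ → A} (hF : Orthogonal T v vh F Fh) (a : A) :
    Orthogonal T v vh (a • F) (a • Fh) where
  bdd := hF.bdd.smul a
  bddHat := hF.bddHat.smul a
  pair_eq w := by
    rw [pair_smul_left hF.bdd (hv.flows T _ w), pair_smul_left hF.bddHat (hvh.flows T _ w),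
      hF.pair_eq]

/-- By the product rule a derivative on the first factor is the derivative of the whole pairing
minus one on the second factor, which merely lengthens the word. -/
theorem Orthogonal.flow {F Fh : ℤ → A} (hF : Orthogonal T v vh F Fh) (σ : Time) :
    Orthogonal T v vh (T.flow Phase.xi σ F) (T.flow Phase.xiHat σ Fh) where
  bdd := hF.bdd.flow T _ σ
  bddHat := hF.bddHat.flow T _ σ
  pair_eq w := by
    have h1 := der_pair_flow T Phase.xi hF.bdd (hv.flows T (Phase.xi.smul (-1)) w) σ
    have h2 := der_pair_flow T Phase.xiHat hF.bddHat (hvh.flows T (Phase.xiHat.smul (-1)) w) σ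
    have h3 := hF.pair_eq (σ :: w)
    rw [hF.pair_eq, h2] at h1
    exact (add_right_cancel (h1.trans (congrArg _ h3))).symm

theorem Orthogonal.d_mul {F Fh : ℤ → A} (hF : Orthogonal T v vh F Fh) :
    Orthogonal T v vh (Op.mul (Op.monomial 1 1) F) (Op.mul (Op.monomial 1 1) Fh) := by
  rw [← flow_xi_x T, ← flow_xiHat_x T]
  exact hF.flow hv hvh _

theorem Orthogonal.differential_mul {N : ℕ} {M : Op A} (hM : NonNeg M)
    (hN : ∀ n : ℤ, N ≤ n → M n = 0) {F Fh : ℤ → A} (hF : Orthogonal T v vh F Fh) :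
    Orthogonal T v vh (Op.mul M F) (Op.mul M Fh) := by
  induction N generalizing M F Fh with
  | zero =>
    have h0 : M = 0 := funext fun n => by
      rcases lt_or_ge n 0 with h | h
      · exact hM n h
      · exact hN n (by simpa using h)
    rw [h0, op_zero_mul, op_zero_mul]
    simpa using hF.smul hv hvh 0
  | succ N ih =>
    set M' : Op A := fun n => if 0 ≤ n then M (n + 1) else 0 with hM'
    have h1 : NonNeg M' := fun n hn => if_neg (by omega)
    have h2 : ∀ n : ℤ, N ≤ n → M' n = 0 := fun n hn => by
      rw [hM']
      dsimp only
      rw [if_pos (by omega), hN _ (by push_cast; omega)]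
    -- Horner's scheme M = M₀ + M'∂ reduces the order; ∂ is absorbed into the pair by
    -- `Orthogonal.d_mul`.
    have h3 : M = Op.monomial (M 0) 0 + Op.mul M' (Op.monomial 1 1) := funext fun n => by
      rw [Pi.add_apply, mul_monomial_one, Op.monomial]
      rcases lt_trichotomy n 0 with hn | rfl | hn
      · rw [hM n hn, if_neg hn.ne, h1 _ (by omega), add_zero]
      · rw [if_pos rfl, h1 _ (by omega), add_zero]
      · rw [if_neg hn.ne', zero_add, hM']
        dsimp only
        rw [if_pos (by omega), sub_add_cancel]
    have ha : ∀ s, InAlg s M' := fun s => by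
      cases s
      · exact HalfBdd.inAlg ⟨-N, fun i hi => by
          rcases lt_or_ge i 0 with h | h
          · exact h1 i h
          · exact h2 i (by simp only [Bool.false_eq_true, if_false] at hi; omega)⟩
      · exact inAlg_of_nonNeg h1
    have hm : ∀ (s : Bool) (a : A) (q : ℤ), InAlg s (Op.monomial a q) := inAlg_monomial
    have hmul : ∀ {s : Bool} {G : Op A}, InAlg s G → Op.mul M G =
        M 0 • G + Op.mul M' (Op.mul (Op.monomial 1 1) G) := fun {s G} hG => by
      conv_lhs => rw [h3]
      rw [op_add_mul (hm s _ _) ((ha s).mul (hm s _ _)) hG, op_mul_assoc (ha s) (hm s _ _) hG,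
        monomial_zero_mul]
    rw [hmul hF.bdd.inAlg, hmul hF.bddHat.inAlg]
    exact (hF.smul hv hvh _).add hv hvh (ih h1 h2 (hF.d_mul hv hvh))

end OrthogonalClosure

/-! ### Vanishing of orthogonal pairs with complementary supports. -/

section OrthogonalUnique

variable {A : Type*} [CommRing A] [Algebra ℚ A] [GradedDifferentialAlgebra A]
variable {T : TimeFlows A} {v vh : ℤ → A}

theorem flows_replicate_nonNeg (hvh : NonNeg vh) (i : ℕ) :
    NonNeg (T.flows (Phase.xiHat.smul (-1)) (List.replicate i (Sum.inl 1)) vh) := by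
  induction i with
  | zero => exact hvh
  | succ i ih =>
    intro n hn
    refine (flow_neg_xiHat_x T _ n).trans ?_
    rw [← TimeFlows.flows, ih n hn, ih (n - 1) (by omega), map_zero, sub_zero]

theorem flows_replicate_isMonic (hv : IsMonic v) (i : ℕ) :
    T.flows (Phase.xi.smul (-1)) (List.replicate i (Sum.inl 1)) v i = (-1) ^ i ∧
    ∀ n : ℤ, i < n → T.flows (Phase.xi.smul (-1)) (List.replicate i (Sum.inl 1)) v n = 0 := by
  induction i with
  | zero => simpa [TimeFlows.flows, IsMonic] using hv
  | succ i ih =>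
    constructor
    · refine (flow_neg_xi_x T _ _).trans ?_
      rw [← TimeFlows.flows, ih.2 _ (by push_cast; omega), map_zero, Nat.cast_succ,
        add_sub_cancel_right, ih.1, pow_succ]
      ring
    · intro n hn
      refine (flow_neg_xi_x T _ _).trans ?_
      rw [← TimeFlows.flows, ih.2 n (by push_cast at hn; omega),
        ih.2 (n - 1) (by push_cast at hn; omega), map_zero, sub_zero]

/-- A pair with only negative powers in the first and only nonnegative powers in the second
component vanishes. -/
theorem Orthogonal.eq_zero (hv : IsMonic v) (hvh : NonNeg vh) (h0 : IsUnit (vh 0))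
    {F Fh : ℤ → A} (hF : Orthogonal T v vh F Fh) (hneg : ∀ n, 0 ≤ n → F n = 0)
    (hpos : NonNeg Fh) : F = 0 ∧ Fh = 0 := by
  have h1 : ∀ i : ℕ, F (-1 - i) = 0 := fun i => by
    induction i using Nat.strong_induction_on with
    | _ i ih =>
      -- The `i`-th x-derivative of the adjoint function has leading term (-z)^i, which isolates the
      -- coefficient of z^{-1-i} once the higher ones vanish. The other side is a residue of two
      -- series without negative powers.
      have h := hF.pair_eq (List.replicate i (Sum.inl 1))
      obtain ⟨h2, h3⟩ := flows_replicate_isMonic (T := T) hv i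
      rw [pair_nonNeg hpos (flows_replicate_nonNeg hvh i),
        pair_eq_single (-1 - i) i (by omega) fun k hk => ?_, h2] at h
      · exact (IsUnit.mul_left_eq_zero (isUnit_one.neg.pow i)).1 h
      · rcases lt_or_ge k (-1 - i) with hki | hki
        · exact Or.inr (h3 _ (by omega))
        · rcases lt_or_ge k 0 with hk0 | hk0
          · have := ih (-1 - k).toNat (by omega)
            rw [show -1 - (((-1 - k).toNat : ℕ) : ℤ) = k by omega] at this
            exact Or.inl this
          · exact Or.inl (hneg k hk0)
  have hF0 : F = 0 := funext fun n => by
    rcases lt_or_ge n 0 with hn | hn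
    · have := h1 (-1 - n).toNat
      rwa [show -1 - (((-1 - n).toNat : ℕ) : ℤ) = n by omega] at this
    · exact hneg n hn
  refine ⟨hF0, ?_⟩
  have h4 : ∀ i : ℕ, Fh i = 0 := fun i => by
    induction i using Nat.strong_induction_on with
    | _ i ih =>
      -- The derivative in t̂_{i+1} has lowest term `vh 0` z^{-(i+1)} with invertible coefficient,
      -- and so isolates `Fh i`.
      have hw : ∀ n, T.flows (Phase.xiHat.smul (-1)) [Sum.inr i.succPNat] vh n =
          T.der (Sum.inr i.succPNat) (vh n) + vh (n + (i + 1)) := fun n => by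
        refine (flow_neg_xiHat_inr T _ _ n).trans ?_
        simp
      have h := hF.pair_eq [Sum.inr i.succPNat]
      rw [hF0, pair, finsum_eq_zero_of_forall_eq_zero fun i => by rw [Pi.zero_apply, zero_mul],
        pair_eq_single i (-1 - i) (by omega) fun k hk => ?_, hw, hvh (-1 - i) (by omega), map_zero,
        zero_add, show -1 - (i : ℤ) + (i + 1) = 0 by ring] at h
      · exact (IsUnit.mul_left_eq_zero h0).1 h.symm
      · rcases lt_or_ge k 0 with hk0 | hk0
        · exact Or.inl (hpos k hk0)
        · rcases lt_or_ge k i with hki | hki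
          · have := ih k.toNat (by omega)
            rw [show ((k.toNat : ℕ) : ℤ) = k by omega] at this
            exact Or.inl this
          · refine Or.inr ?_
            rw [hw, hvh (-1 - k) (by omega), hvh _ (by omega), map_zero, add_zero]
  funext n
  rcases lt_or_ge n 0 with hn | hn
  · exact hpos n hn
  · lift n to ℕ using hn
    exact h4 n

end OrthogonalUnique

/-! ### From orthogonality to the hierarchy. -/

namespace Dressing

variable {A : Type*} [CommRing A] [Algebra ℚ A] [GradedDifferentialAlgebra A]
variable {S : Dressing A} {T : TimeFlows A} {v vh : ℤ → A}

theorem flow_phiHat_of_neg (k : ℕ) {n : ℤ} (hn : n < 0) :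
    T.flow Phase.xiHat (Sum.inr k.succPNat) S.PhiHat n = -S.PhiHat (n + (k + 1)) := by
  rw [flow_xiHat_inr, Pi.sub_apply, mul_monomial_one, nonNeg_derOp_phiHat _ n hn, zero_sub,
    sub_neg_eq_add]
  simp

/-- With M = (FΦ⁻¹)_+, the pair minus M(Φ, Φ̂) is orthogonal, has negative powers only in the first
component and none in the second, and therefore vanishes. -/
theorem exists_op_of_nonNeg (hv : IsMonic v) (hvh : NonNeg vh) (h0 : IsUnit (vh 0))
    (hS : Orthogonal T v vh S.Phi S.PhiHat) {F Fh : ℤ → A} (hF : Orthogonal T v vh F Fh)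
    (hpos : NonNeg Fh) : ∃ R : Op A, InAlg false R ∧ InAlg true R ∧
      F = Op.mul R S.Phi ∧ Fh = Op.mul R S.PhiHat := by
  have hFX : InAlg false (Op.mul F S.PhiInv) := hF.bdd.inAlg.mul S.inAlg_phiInv
  set M : Op A := Op.pos (Op.mul F S.PhiInv) with hM
  have hM0 : NonNeg M := pos_nonNeg _
  have hMm : InAlg false M := hFX.pos
  have hMp : InAlg true M := inAlg_of_nonNeg hM0
  obtain ⟨N, hN⟩ := mem_DMinus_iff.2 hMm
  have hMS : Orthogonal T v vh (Op.mul M S.Phi) (Op.mul M S.PhiHat) :=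
    hS.differential_mul hv.halfBdd hvh.halfBdd (N := (N + 1).toNat) hM0
      fun n hn => hN n (by omega)
  have hD := hF.add hv.halfBdd hvh.halfBdd (hMS.smul hv.halfBdd hvh.halfBdd (-1))
  have hFM : F + (-1 : A) • Op.mul M S.Phi =
      Op.mul (Op.neg (Op.mul F S.PhiInv)) S.Phi := by
    have h1 : Op.mul (Op.mul F S.PhiInv) S.Phi = F :=
      mul_cancel_right S.inAlg_phiInv S.inAlg_phi hF.bdd.inAlg S.phiInv_mul_phi
    have h2 := op_add_mul hMm hFX.negPart S.inAlg_phi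
    rw [hM, pos_add_neg, h1, ← hM] at h2
    rw [neg_one_smul, ← sub_eq_add_neg, sub_eq_iff_eq_add']
    exact h2
  obtain ⟨h1, h2⟩ := hD.eq_zero hv hvh h0 (by
    rw [hFM, ← fil_false_one_iff]
    simpa using (fil_neg (Op.mul F S.PhiInv)).mul S.fil_phi) (by
    rw [neg_one_smul, ← sub_eq_add_neg]
    exact hpos.sub (hM0.mul S.phiHat_nonNeg))
  rw [neg_one_smul, ← sub_eq_add_neg, sub_eq_zero] at h1 h2
  exact ⟨M, hMm, hMp, h1, h2⟩

/-- Orthogonality forces a pair to be obtained from `(Φ, Φ̂)` by a single operator. -/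
theorem exists_op (hv : IsMonic v) (hvh : NonNeg vh) (h0 : IsUnit (vh 0))
    (hS : Orthogonal T v vh S.Phi S.PhiHat) {k : ℕ} {F Fh : ℤ → A}
    (hF : Orthogonal T v vh F Fh) (hk : ∀ i : ℤ, i < -k → Fh i = 0) :
    ∃ R : Op A, InAlg false R ∧ InAlg true R ∧
      F = Op.mul R S.Phi ∧ Fh = Op.mul R S.PhiHat := by
  induction k generalizing F Fh with
  | zero => exact exists_op_of_nonNeg hv hvh h0 hS hF fun n hn => hk n (by simpa using hn)
  | succ k ih =>
    have hv' := hv.halfBdd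
    have hvh' := hvh.halfBdd
    have hm : ∀ (s : Bool) (a : A) (q : ℤ), InAlg s (Op.monomial a q) := inAlg_monomial
    set e : Aˣ := S.expf
    -- The t̂_{k+1}-derivative of (ψ, ψ̂) serves as a reference pair, with lowest term -e^f
    -- z^{-(k+1)} in the second component.
    have hZ := hS.flow hv' hvh' (Sum.inr k.succPNat)
    set Z := T.flow Phase.xi (Sum.inr k.succPNat) S.Phi
    set Zh := T.flow Phase.xiHat (Sum.inr k.succPNat) S.PhiHat
    have hZn : ∀ n : ℤ, n < 0 → Zh n = -S.PhiHat (n + (k + 1)) := fun n hn =>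
      flow_phiHat_of_neg k hn
    have hZlow : ∀ n : ℤ, n < -((k : ℤ) + 1) → Zh n = 0 := fun n hn => by
      rw [hZn n (by omega), S.phiHat_nonNeg _ (by omega), neg_zero]
    have hZlead : Zh (-((k : ℤ) + 1)) = -e := by
      rw [hZn _ (by omega), neg_add_cancel, phiHat_zero]
    have hG := hZ.smul hv' hvh' ((e⁻¹ : Aˣ) : A)
    -- After division by e^f the lowest coefficient is the constant -1, which ∂ kills: the pair
    -- gains one order and falls under the induction hypothesis.
    obtain ⟨R', hR'm, hR'p, h1, h2⟩ := ih (hG.d_mul hv' hvh') (fun i hi => by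
      rw [d_mul_op, Pi.smul_apply, Pi.smul_apply, hZlow (i - 1) (by omega), smul_zero, add_zero]
      rcases (show i ≤ -((k : ℤ) + 1) by omega).eq_or_lt with rfl | h
      · rw [hZlead, smul_eq_mul, mul_neg, Units.inv_mul, map_neg, Derivation.map_one_eq_zero,
          neg_zero]
      · rw [hZlow i h, smul_zero, map_zero])
    -- Since ∂⁻¹ exists in both algebras, ∂ e^{-f} can be undone, so the reference pair itself is
    -- Q(Φ, Φ̂).
    set Q : Op A := Op.mul (Op.monomial (e : A) (-1)) R'
    have hQ : ∀ {s : Bool} {X Y : Op A}, InAlg s X → InAlg s Y → InAlg s R' →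
        Op.mul (Op.monomial 1 1) (((e⁻¹ : Aˣ) : A) • X) = Op.mul R' Y → X = Op.mul Q Y := by
      intro s X Y hX hY hR' h
      rw [← monomial_zero_mul] at h
      have h3 : Op.mul (Op.monomial (e : A) (-1)) (Op.mul (Op.monomial 1 1)
          (Op.mul (Op.monomial ((e⁻¹ : Aˣ) : A) 0) X)) = X := by
        rw [← op_mul_assoc (hm s _ _) (hm s _ _) ((hm s _ _).mul hX), monomial_mul_monomial_one,
          neg_add_cancel, monomial_zero_mul, monomial_zero_mul, smul_smul, Units.mul_inv, one_smul]
      rw [op_mul_assoc (hm s _ _) hR' hY, ← h, h3]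
    have hZQ : Z = Op.mul Q S.Phi := hQ hZ.bdd.inAlg S.inAlg_phi hR'm h1
    have hZQ' : Zh = Op.mul Q S.PhiHat := hQ hZ.bddHat.inAlg S.inAlg_phiHat hR'p h2
    have hQa : ∀ {s : Bool}, InAlg s R' → InAlg s Q := fun h => (hm _ _ _).mul h
    -- Chosen so that adding `c` times the reference pair cancels the lowest term of `Fh`.
    set c : A := Fh (-((k : ℤ) + 1)) * ((e⁻¹ : Aˣ) : A)
    obtain ⟨R, hRm, hRp, h3, h4⟩ := ih (hF.add hv' hvh' (hZ.smul hv' hvh' c)) (fun i hi => by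
      rw [Pi.add_apply, Pi.smul_apply]
      rcases (show i ≤ -((k : ℤ) + 1) by omega).eq_or_lt with rfl | h
      · rw [hZlead, smul_eq_mul, mul_neg, Units.inv_mul_cancel_right, add_neg_cancel]
      · rw [hZlow i h, hk i (by push_cast; omega), smul_zero, add_zero])
    have hfin : ∀ {s : Bool} {X Y W : Op A}, InAlg s W → InAlg s R → InAlg s R' →
        Y = Op.mul Q W → X + c • Y = Op.mul R W →
        X = Op.mul (R - Op.mul (Op.monomial c 0) Q) W := by
      intro s X Y W hW hR hR' hY h
      rw [op_sub_mul hR ((hm s _ _).mul (hQa hR')) hW, op_mul_assoc (hm s _ _) (hQa hR') hW, ← h,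
        ← hY, monomial_zero_mul, add_sub_cancel_right]
    exact ⟨R - Op.mul (Op.monomial c 0) Q, hRm.sub ((hm _ _ _).mul (hQa hR'm)),
      hRp.sub ((hm _ _ _).mul (hQa hR'p)), hfin S.inAlg_phi hRm hR'm hZQ h3,
      hfin S.inAlg_phiHat hRp hR'p hZQ' h4⟩

theorem isCompatible_of_orthogonal (hv : IsMonic v) (hvh : NonNeg vh) (h0 : IsUnit (vh 0))
    (hS : Orthogonal T v vh S.Phi S.PhiHat) : S.IsCompatible T := fun σ => by
  have h := hS.flow hv.halfBdd hvh.halfBdd σ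
  obtain ⟨k, hk⟩ := h.bddHat
  exact exists_op (k := (-k).toNat) hv hvh h0 hS h fun i hi => hk i (by simp; omega)

theorem flows_phi_replicate (i : ℕ) :
    T.flows Phase.xi (List.replicate i (Sum.inl 1)) S.Phi i = 1 ∧
    ∀ n : ℤ, i < n → T.flows Phase.xi (List.replicate i (Sum.inl 1)) S.Phi n = 0 := by
  induction i with
  | zero => exact ⟨S.phi_zero, fun n hn => S.phi_of_pos hn⟩
  | succ i ih =>
    have h : ∀ n, T.flows Phase.xi (List.replicate (i + 1) (Sum.inl 1)) S.Phi n =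
        d (T.flows Phase.xi (List.replicate i (Sum.inl 1)) S.Phi n) +
          T.flows Phase.xi (List.replicate i (Sum.inl 1)) S.Phi (n - 1) := fun n =>
      (congrFun (flow_xi_x T _) n).trans (d_mul_op _ n)
    constructor
    · rw [h, ih.2 _ (by push_cast; omega), map_zero, Nat.cast_succ, add_sub_cancel_right, ih.1,
        zero_add]
    · intro n hn
      rw [h, ih.2 n (by push_cast at hn; omega), ih.2 (n - 1) (by push_cast at hn; omega),
        map_zero, add_zero]

theorem nonNeg_flows_phiHat_replicate (i : ℕ) :
    NonNeg (T.flows Phase.xiHat (List.replicate i (Sum.inl 1)) S.PhiHat) := by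
  induction i with
  | zero => exact S.phiHat_nonNeg
  | succ i ih =>
    intro n hn
    refine (congrFun (flow_xiHat_x T _) n).trans ?_
    rw [d_mul_op, ← TimeFlows.flows, ih n hn, ih _ (by omega), map_zero, add_zero]

theorem _root_.ExtendedKP.Orthogonal.flows {F Fh : ℤ → A} (hv : HalfBdd false v)
    (hvh : HalfBdd true vh) (hF : Orthogonal T v vh F Fh) (w : List Time) :
    Orthogonal T v vh (T.flows Phase.xi w F) (T.flows Phase.xiHat w Fh) := by
  induction w with
  | nil => exact hF
  | cons σ w ih => exact ih.flow hv hvh σ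

/-- The adjoint wave functions are determined by the bilinear equation. -/
theorem orthogonal_unique {v' vh' : ℤ → A} (hv : IsMonic v) (hvh : NonNeg vh) (hv' : IsMonic v')
    (hvh' : NonNeg vh') (hS : Orthogonal T v vh S.Phi S.PhiHat)
    (hS' : Orthogonal T v' vh' S.Phi S.PhiHat) : v = v' ∧ vh = vh' := by
  have hsub : ∀ {s : Bool} {u x y : ℤ → A}, HalfBdd s u → HalfBdd s x → HalfBdd s y →
      pair u (x - y) = pair u x - pair u y := fun hu hx hy => by
    rw [sub_eq_add_neg, ← neg_one_smul A, pair_add_right hu hx (hy.smul _),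
      pair_smul_right hu hy, neg_one_mul, sub_eq_add_neg]
  have hδ : ∀ n : ℤ, 0 ≤ n → (v - v') n = 0 := fun n hn => by
    rcases hn.eq_or_lt with rfl | hn
    · rw [Pi.sub_apply, hv.1, hv'.1, sub_self]
    · rw [Pi.sub_apply, hv.2 n hn, hv'.2 n hn, sub_self]
  have h1 : ∀ i : ℕ, (v - v') (-1 - i) = 0 := fun i => by
    induction i using Nat.strong_induction_on with
    | _ i ih =>
      -- Dually, the `i`-th x-derivative of ψ has leading term z^i and isolates one coefficient of
      -- `v - v'`; the residues on the other side vanish.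
      have hO := hS.flows hv.halfBdd hvh.halfBdd (List.replicate i (Sum.inl 1))
      have hO' := hS'.flows hv'.halfBdd hvh'.halfBdd (List.replicate i (Sum.inl 1))
      have hp := (hO.pair_eq []).trans (pair_nonNeg (nonNeg_flows_phiHat_replicate i) hvh)
      have hp' := (hO'.pair_eq []).trans (pair_nonNeg (nonNeg_flows_phiHat_replicate i) hvh')
      have h := hsub hO.bdd hv.halfBdd hv'.halfBdd
      obtain ⟨h2, h3⟩ := flows_phi_replicate (T := T) (S := S) i
      rw [show pair _ v = 0 from hp, show pair _ v' = 0 from hp', sub_zero,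
        pair_eq_single i (-1 - i) (by omega) fun k hk => ?_, h2, one_mul] at h
      · exact h
      · rcases lt_or_ge (i : ℤ) k with hki | hki
        · exact Or.inl (h3 k hki)
        · refine Or.inr ?_
          rcases lt_or_ge k 0 with hk0 | hk0
          · exact hδ _ (by omega)
          · lift k to ℕ using hk0
            exact ih k (by omega)
  have hvv : v = v' := sub_eq_zero.1 <| funext fun n => by
    rcases lt_or_ge n 0 with hn | hn
    · have := h1 (-1 - n).toNat
      rwa [show -1 - (((-1 - n).toNat : ℕ) : ℤ) = n by omega] at this
    · exact hδ n hn
  refine ⟨hvv, ?_⟩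
  subst hvv
  have hδh : NonNeg (vh - vh') := hvh.sub hvh'
  have h4 : ∀ i : ℕ, (vh - vh') i = 0 := fun i => by
    induction i using Nat.strong_induction_on with
    | _ i ih =>
      -- The first components now agree, so the second pairings do as well; the lowest term -e^f
      -- z^{-(i+1)} of the t̂_{i+1}-derivative of ψ̂ isolates the coefficient `i` of the difference.
      have hO := hS.flow hv.halfBdd hvh.halfBdd (Sum.inr i.succPNat)
      have hO' := hS'.flow hv.halfBdd hvh'.halfBdd (Sum.inr i.succPNat)
      have h := hsub hO.bddHat hvh.halfBdd hvh'.halfBdd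
      have hZ : ∀ n : ℤ, n < 0 → T.flow Phase.xiHat (Sum.inr i.succPNat) S.PhiHat n =
          -S.PhiHat (n + (i + 1)) := fun n hn => flow_phiHat_of_neg i hn
      rw [sub_eq_zero.2 (show pair _ vh = pair _ vh' from
        (hO.pair_eq []).symm.trans (hO'.pair_eq [])),
        pair_eq_single (-1 - i) i (by omega) fun k hk => ?_, hZ _ (by omega),
        show -1 - (i : ℤ) + (i + 1) = 0 by ring, phiHat_zero] at h
      · exact (IsUnit.mul_right_eq_zero S.expf.isUnit.neg).1 h
      · rcases lt_or_ge k 0 with hk0 | hk0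
        · rcases lt_or_ge k (-1 - i) with hki | hki
          · left
            rw [hZ k hk0, S.phiHat_nonNeg _ (by omega), neg_zero]
          · right
            have := ih (-1 - k).toNat (by omega)
            rwa [show (((-1 - k).toNat : ℕ) : ℤ) = -1 - k by omega] at this
        · exact Or.inr (hδh _ (by omega))
  refine sub_eq_zero.1 <| funext fun n => ?_
  rcases lt_or_ge n 0 with hn | hn
  · exact hδh n hn
  · lift n to ℕ using hn
    exact h4 n

theorem orthogonal_of_residue_eq {χ χ' : Phase} (hv : HalfBdd false v) (hvh : HalfBdd true vh)
    (h : T.residue ⟨S.Phi, χ⟩ ⟨v, Phase.xi.smul (-1)⟩ =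
      T.residue ⟨S.PhiHat, χ'⟩ ⟨vh, Phase.xiHat.smul (-1)⟩) :
    Orthogonal T v vh S.Phi S.PhiHat where
  bdd := S.inAlg_phi.halfBdd
  bddHat := S.phiHat_nonNeg.halfBdd
  pair_eq := (residue_eq_iff T S.inAlg_phi.halfBdd hv S.phiHat_nonNeg.halfBdd hvh).1 h

end Dressing

end ExtendedKP

/-! ### Assembly of the two directions. -/

theorem mainTheorem1 {A : Type*} [CommRing A] [Algebra ℚ A]
    [ExtendedKP.GradedDifferentialAlgebra A] (T : ExtendedKP.TimeFlows A) :
    (∀ S : ExtendedKP.Dressing A, S.IsSolution T →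
      T.Bilinear S.psi S.psiDag S.psiHat S.psiHatDag ∧
      S.psi = ExtendedKP.waveXi 1 S.a ∧
      S.psiHat = ExtendedKP.waveXiHat 1 (S.expf : A) 1 S.b ∧
      (∃ ad : ℕ+ → A, S.psiDag = ExtendedKP.waveXi (-1) ad) ∧
      (∃ (ρ : Aˣ) (bd : ℕ+ → A), ExtendedKP.DegGE 1 ((ρ : A) - 1) ∧
        S.psiHatDag = ExtendedKP.waveXiHat (-1) ((S.expf⁻¹ : Aˣ) : A) (ρ : A) bd)) ∧
    (∀ (a : ℕ+ → A) (expf : Aˣ) (b : ℕ+ → A) (ad : ℕ+ → A) (ρ : Aˣ) (bd : ℕ+ → A),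
      T.Bilinear (ExtendedKP.waveXi 1 a) (ExtendedKP.waveXi (-1) ad)
        (ExtendedKP.waveXiHat 1 (expf : A) 1 b)
        (ExtendedKP.waveXiHat (-1) ((expf⁻¹ : Aˣ) : A) (ρ : A) bd) →
      ∃ S : ExtendedKP.Dressing A, S.IsSolution T ∧
        ExtendedKP.waveXi 1 a = S.psi ∧
        ExtendedKP.waveXi (-1) ad = S.psiDag ∧
        ExtendedKP.waveXiHat 1 (expf : A) 1 b = S.psiHat ∧
        ExtendedKP.waveXiHat (-1) ((expf⁻¹ : Aˣ) : A) (ρ : A) bd = S.psiHatDag) := by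
  open ExtendedKP in
  refine ⟨fun S hS => ⟨(Dressing.isSolution_iff.1 hS).bilinear, S.psi_eq, S.psiHat_eq,
    ⟨_, congrArg (fun u => (⟨u, Phase.xi.smul (-1)⟩ : Wave A))
      S.isMonic_psiDag.eq_nonposSeries⟩, ?_⟩, ?_⟩
  · obtain ⟨ρ, hρ⟩ := isUnit_of_degGE_one S.degGE_psiHatDag_zero
    refine ⟨ρ, fun k => S.expf * S.psiHatDag.coeff k, by rw [hρ]; exact S.degGE_psiHatDag_zero, ?_⟩
    rw [hρ]
    exact congrArg (fun u => (⟨u, Phase.xiHat.smul (-1)⟩ : Wave A))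
      (S.nonNeg_psiHatDag.eq_nonnegSeries S.expf)
  · intro a expf b ad ρ bd h
    let S : Dressing A := ⟨a, expf, b⟩
    have hv := isMonic_nonposSeries ad
    have hvh := nonNeg_nonnegSeries ((expf⁻¹ : Aˣ) : A) (ρ : A) bd
    have hO : Orthogonal T _ _ S.Phi S.PhiHat :=
      Dressing.orthogonal_of_residue_eq hv.halfBdd hvh.halfBdd h
    -- The constant coefficient of the given ψ̂† is e^{-f}ρ; only its invertibility matters, so ρ
    -- may be any unit.
    have hC : S.IsCompatible T :=
      Dressing.isCompatible_of_orthogonal hv hvh (expf⁻¹ * ρ : Aˣ).isUnit hO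
    -- The direct part supplies the bilinear equation for the genuine adjoint functions, which can
    -- then be compared with the given ones.
    have hB := hC.bilinear
    rw [TimeFlows.Bilinear, S.psi_eq, S.psiHat_eq] at hB
    obtain ⟨h1, h2⟩ := Dressing.orthogonal_unique hv hvh S.isMonic_psiDag S.nonNeg_psiHatDag hO
      (Dressing.orthogonal_of_residue_eq S.isMonic_psiDag.halfBdd S.nonNeg_psiHatDag.halfBdd hB)
    exact ⟨S, Dressing.isSolution_iff.2 hC, S.psi_eq.symm,
      congrArg (fun u => (⟨u, Phase.xi.smul (-1)⟩ : Wave A)) h1, S.psiHat_eq.symm,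
      congrArg (fun u => (⟨u, Phase.xiHat.smul (-1)⟩ : Wave A)) h2⟩
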